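/- Setting. Let $m$ agents observe subsets of the $d$ coordinates of feature vectors in $\mathbb{R}^d$. Agent $i$ observes $d_i$ coordinates; for $v\in\mathbb{R}^d$ write $v_{i+}\in\mathbb{R}^{d_i}$ and $v_{i-}\in\mathbb{R}^{d-d_i}$ for the observed and unobserved parts, i.e. $v_{i+}=\Pi_{i+}v$, $v_{i-}=\Pi_{i-}v$, where $\Pi_i=\begin{bmatrix}\Pi_{i+}\\ \Pi_{i-}\end{bmatrix}$ is a permutation matrix, and for $A\in\mathbb{R}^{d\times d}$ write $A_{i+}=\Pi_{i+}A\Pi_{i+}^\top$, $A_{i-}=\Pi_{i-}A\Pi_{i-}^\top$, $A_{i\pm}=\Pi_{i+}A\Pi_{i-}^\top$, $A_{i\mp}=\Pi_{i-}A\Pi_{i+}^\top$. Assume that every coordinate is observed by at least one agent. Let $\Sigma\succ0$, $\theta\in\mathbb{R}^d$ and $\sigma\ge 0$ be fixed, and set $\|v\|_A^2=\langle v,Av\rangle$, $$T_i=\begin{bmatrix} I_{d_i} & \Sigma_{i+}^{-1}\Sigma_{i\pm}\end{bmatrix}\Pi_i,\qquad \Gamma_{i-}=\Sigma_{i-}-\Sigma_{i\mp}\Sigma_{i+}^{-1}\Sigma_{i\pm},\qquad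 W_i^{\mathrm g}=\frac{\Sigma_{i+}}{\|\theta_{i-}\|_{\Gamma_{i-}}^2+\sigma^2},\qquad C^{\mathrm g}=\Bigl(\sum_{i=1}^m T_i^\top W_i^{\mathrm g}T_i\Bigr)^{-1},$$ where $\|\theta_{i-}\|_{\Gamma_{i-}}^2+\sigma^2>0$ is assumed for all $i$ (automatic if $\sigma>0$). Agent $i$ has $n$ samples: the rows of $X_i\in\mathbb{R}^{n\times d}$ are $\mathsf N(0,\Sigma)$, $y_i=X_i\theta+\xi_i$ with $\xi_i\sim\mathsf N(0,\sigma^2I_n)$, and all feature vectors and noise variables, within and across agents, are independent. Let $X_{i+}$ be the observed columns of $X_i$, and let $$\hat\theta_i=(X_{i+}^\top X_{i+})^{-1}X_{i+}^\top y_i,\qquad R_i=\tfrac1n\|X_{i+}\hat\theta_i-y_i\|_2^2,\qquad \hat\Sigma_{i+}=\tfrac1nX_{i+}^\top X_{i+}.$$ For positive definite $W_i\in\mathbb{R}^{d_i\times d_i}$ let $$\hat\theta(W_1,\dots,W_m)=\operatorname*{argmin}_{t\in\mathbb{R}^d}\sum_{i=1}^m\bigl\|t_{i+}+\Sigma_{i+}^{-1}\Sigma_{i\pm}t_{i-}-\hat\theta_i\bigr\|_{W_i}^2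 ,$$ $$C(W_1,\dots,W_m)=\Bigl(\sum_i T_i^\top W_iT_i\Bigr)^{-1}\Bigl(\sum_i T_i^\top W_i(W_i^{\mathrm g})^{-1}W_iT_i\Bigr)\Bigl(\sum_i T_i^\top W_iT_i\Bigr)^{-1}.$$ The Collab estimators are $\hat\theta^{\mathrm{clb}}=\hat\theta(\hat W_1,\dots,\hat W_m)$ and $\hat\theta_i^{\mathrm{clb}}=T_i\hat\theta^{\mathrm{clb}}$, where either $\hat W_i=\hat\Sigma_{i+}/R_i$ for all $i$ or $\hat W_i=\Sigma_{i+}/R_i$ for all $i$. Claim. For either choice of $\hat W_i$, the probability that all $\hat W_i$ are positive definite tends to $1$ and, as $n\to\infty$, $$\sqrt n\,(\hat\theta^{\mathrm{clb}}-\theta)\xrightarrow{d}\mathsf N(0,C^{\mathrm g}),\qquad \sqrt n\,(\hat\theta_i^{\mathrm{clb}}-T_i\theta)\xrightarrow{d}\mathsf N(0,T_iC^{\mathrm g}T_i^\top)\quad\text{for every } i .$$ (These limits do not depend on how $\hat\theta^{\mathrm{clb}}$ is defined, measurably, where some $\hat W_i$ is not positive definite.) Moreover: (i) For all fixed positive definite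 $W_1,\dots,W_m$, the matrix $\sum_iT_i^\top W_iT_i$ is positive definite, the argmin is unique, $\sqrt n\,(\hat\theta(W_1,\dots,W_m)-\theta)\xrightarrow{d}\mathsf N(0,C(W_1,\dots,W_m))$, and $$C(W_1,\dots,W_m)\succeq C(W_1^{\mathrm g},\dots,W_m^{\mathrm g})=C^{\mathrm g};$$ the $W_i^{\mathrm g}$ are themselves positive definite, so they are the optimal weights. (ii) For every $i$, $\sqrt n\,(\hat\theta_i-T_i\theta)\xrightarrow{d}\mathsf N(0,(W_i^{\mathrm g})^{-1})$, and $(W_i^{\mathrm g})^{-1}\succeq T_iC^{\mathrm g}T_i^\top$. -/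

import Mathlib

open MeasureTheory ProbabilityTheory Filter Topology Matrix
open scoped NNReal

noncomputable section

namespace Collab

section OneAgent

/-! An agent's view is a bijection `e : Fin p ⊕ Fin q ≃ Fin d`: `e (Sum.inl a)` is its `a`-th
observed coordinate, `e (Sum.inr b)` its `b`-th unobserved coordinate.  It is the permutation
matrix with block rows `Π₊` (observed) and `Π₋` (unobserved). -/

variable {p q d n : ℕ}

/-- The observed part `v₊ = Π₊ v`. -/
def obs (e : Fin p ⊕ Fin q ≃ Fin d) (v : Fin d → ℝ) : Fin p → ℝ := fun a => v (e (Sum.inl a))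

/-- The unobserved part `v₋ = Π₋ v`. -/
def unobs (e : Fin p ⊕ Fin q ≃ Fin d) (v : Fin d → ℝ) : Fin q → ℝ := fun b => v (e (Sum.inr b))

/-- `A₊ = Π₊ A Π₊ᵀ`. -/
def blockPP (e : Fin p ⊕ Fin q ≃ Fin d) (A : Matrix (Fin d) (Fin d) ℝ) :
    Matrix (Fin p) (Fin p) ℝ :=
  A.submatrix (fun a => e (Sum.inl a)) (fun a => e (Sum.inl a))

/-- `A± = Π₊ A Π₋ᵀ`. -/
def blockPM (e : Fin p ⊕ Fin q ≃ Fin d) (A : Matrix (Fin d) (Fin d) ℝ) :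
    Matrix (Fin p) (Fin q) ℝ :=
  A.submatrix (fun a => e (Sum.inl a)) (fun b => e (Sum.inr b))

/-- `A∓ = Π₋ A Π₊ᵀ`. -/
def blockMP (e : Fin p ⊕ Fin q ≃ Fin d) (A : Matrix (Fin d) (Fin d) ℝ) :
    Matrix (Fin q) (Fin p) ℝ :=
  A.submatrix (fun b => e (Sum.inr b)) (fun a => e (Sum.inl a))

/-- `A₋ = Π₋ A Π₋ᵀ`. -/
def blockMM (e : Fin p ⊕ Fin q ≃ Fin d) (A : Matrix (Fin d) (Fin d) ℝ) :
    Matrix (Fin q) (Fin q) ℝ :=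
  A.submatrix (fun b => e (Sum.inr b)) (fun b => e (Sum.inr b))

/-- `T = [I  Σ₊⁻¹ Σ±] Π`. -/
def transfer (e : Fin p ⊕ Fin q ≃ Fin d) (S : Matrix (Fin d) (Fin d) ℝ) :
    Matrix (Fin p) (Fin d) ℝ :=
  (Matrix.fromCols (1 : Matrix (Fin p) (Fin p) ℝ)
    ((blockPP e S)⁻¹ * blockPM e S)).submatrix id e.symm

/-- The Schur complement `Γ₋ = Σ₋ - Σ∓ Σ₊⁻¹ Σ±`. -/
def schur (e : Fin p ⊕ Fin q ≃ Fin d) (S : Matrix (Fin d) (Fin d) ℝ) :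
    Matrix (Fin q) (Fin q) ℝ :=
  blockMM e S - blockMP e S * (blockPP e S)⁻¹ * blockPM e S

/-- The quadratic form `‖v‖²_A = ⟨v, A v⟩`. -/
def quad {k : ℕ} (A : Matrix (Fin k) (Fin k) ℝ) (v : Fin k → ℝ) : ℝ := v ⬝ᵥ (A *ᵥ v)

/-- `‖θ₋‖²_{Γ₋} + σ²`. -/
def residualVariance (e : Fin p ⊕ Fin q ≃ Fin d) (S : Matrix (Fin d) (Fin d) ℝ)
    (θ : Fin d → ℝ) (σ : ℝ≥0) : ℝ :=
  quad (schur e S) (unobs e θ) + (σ : ℝ) ^ 2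

/-- `Wᵍ = Σ₊ / (‖θ₋‖²_{Γ₋} + σ²)`. -/
def gaussianWeight (e : Fin p ⊕ Fin q ≃ Fin d) (S : Matrix (Fin d) (Fin d) ℝ)
    (θ : Fin d → ℝ) (σ : ℝ≥0) : Matrix (Fin p) (Fin p) ℝ :=
  (residualVariance e S θ σ)⁻¹ • blockPP e S

/-- The observed columns `X₊` of a full data matrix `X`. -/
def obsData (e : Fin p ⊕ Fin q ≃ Fin d) (X : Matrix (Fin n) (Fin d) ℝ) :
    Matrix (Fin n) (Fin p) ℝ :=
  X.submatrix id (fun a => e (Sum.inl a))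

/-- Ordinary least squares `(AᵀA)⁻¹ Aᵀ y`. -/
def ols (A : Matrix (Fin n) (Fin p) ℝ) (y : Fin n → ℝ) : Fin p → ℝ :=
  (Aᵀ * A)⁻¹ *ᵥ (Aᵀ *ᵥ y)

/-- The training error `(1/n) ‖A θ̂ - y‖²` of ordinary least squares. -/
def trainError (A : Matrix (Fin n) (Fin p) ℝ) (y : Fin n → ℝ) : ℝ :=
  (n : ℝ)⁻¹ * ∑ j, ((A *ᵥ ols A y) j - y j) ^ 2

/-- The sample second-moment matrix `(1/n) AᵀA`. -/
def sampleCov (A : Matrix (Fin n) (Fin p) ℝ) : Matrix (Fin p) (Fin p) ℝ :=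
  (n : ℝ)⁻¹ • (Aᵀ * A)

end OneAgent

section Samples

variable {Ω : Type*} {d : ℕ}

/-- The `n × d` matrix whose rows are the first `n` feature vectors. -/
def dataMatrix (x : ℕ → Ω → EuclideanSpace ℝ (Fin d)) (n : ℕ) (ω : Ω) :
    Matrix (Fin n) (Fin d) ℝ :=
  Matrix.of fun j k => x j ω k

/-- The labels `y = X θ + ξ` of the first `n` samples. -/
def labels (θ : Fin d → ℝ) (x : ℕ → Ω → EuclideanSpace ℝ (Fin d)) (ξ : ℕ → Ω → ℝ)
    (n : ℕ) (ω : Ω) : Fin n → ℝ :=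
  dataMatrix x n ω *ᵥ θ + fun j : Fin n => ξ j ω

/-- The local least squares estimate computed by an agent with view `e` from `n` samples. -/
def localOLS {p q : ℕ} (e : Fin p ⊕ Fin q ≃ Fin d) (θ : Fin d → ℝ)
    (x : ℕ → Ω → EuclideanSpace ℝ (Fin d)) (ξ : ℕ → Ω → ℝ) (n : ℕ) (ω : Ω) : Fin p → ℝ :=
  ols (obsData e (dataMatrix x n ω)) (labels θ x ξ n ω)

/-- The training error `R` of the local least squares estimate. -/
def localError {p q : ℕ} (e : Fin p ⊕ Fin q ≃ Fin d) (θ : Fin d → ℝ)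
    (x : ℕ → Ω → EuclideanSpace ℝ (Fin d)) (ξ : ℕ → Ω → ℝ) (n : ℕ) (ω : Ω) : ℝ :=
  trainError (obsData e (dataMatrix x n ω)) (labels θ x ξ n ω)

/-- Convergence in distribution of the random vectors `Z n` to `N(0, C)`. -/
def TendstoNormal [MeasurableSpace Ω] (P : Measure Ω) [IsProbabilityMeasure P] {k : ℕ}
    (Z : ℕ → Ω → Fin k → ℝ) (C : Matrix (Fin k) (Fin k) ℝ) : Prop :=
  TendstoInDistribution (fun n ω => WithLp.toLp 2 (Z n ω)) atTop
    (id : EuclideanSpace ℝ (Fin k) → EuclideanSpace ℝ (Fin k)) (fun _ => P)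
    (multivariateGaussian 0 C)

end Samples

section Aggregation

variable {m d : ℕ} {p q : Fin m → ℕ}

/-- The weighted risk `∑ᵢ ‖tᵢ₊ + Σᵢ₊⁻¹ Σᵢ± tᵢ₋ - bᵢ‖²_{Wᵢ}`. -/
def weightedRisk (e : ∀ i, Fin (p i) ⊕ Fin (q i) ≃ Fin d) (S : Matrix (Fin d) (Fin d) ℝ)
    (W : ∀ i, Matrix (Fin (p i)) (Fin (p i)) ℝ) (b : ∀ i, Fin (p i) → ℝ) (t : Fin d → ℝ) : ℝ :=
  ∑ i, quad (W i)
    (obs (e i) t + ((blockPP (e i) S)⁻¹ * blockPM (e i) S) *ᵥ unobs (e i) t - b i)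

/-- `t` belongs to the argmin of the weighted risk. -/
def IsRiskMinimizer (e : ∀ i, Fin (p i) ⊕ Fin (q i) ≃ Fin d) (S : Matrix (Fin d) (Fin d) ℝ)
    (W : ∀ i, Matrix (Fin (p i)) (Fin (p i)) ℝ) (b : ∀ i, Fin (p i) → ℝ) (t : Fin d → ℝ) : Prop :=
  ∀ u, weightedRisk e S W b t ≤ weightedRisk e S W b u

/-- `∑ᵢ Tᵢᵀ Wᵢ Tᵢ`. -/
def information (e : ∀ i, Fin (p i) ⊕ Fin (q i) ≃ Fin d) (S : Matrix (Fin d) (Fin d) ℝ)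
    (W : ∀ i, Matrix (Fin (p i)) (Fin (p i)) ℝ) : Matrix (Fin d) (Fin d) ℝ :=
  ∑ i, (transfer (e i) S)ᵀ * W i * transfer (e i) S

/-- `Cᵍ = (∑ᵢ Tᵢᵀ Wᵢᵍ Tᵢ)⁻¹`. -/
def gaussianCov (e : ∀ i, Fin (p i) ⊕ Fin (q i) ≃ Fin d) (S : Matrix (Fin d) (Fin d) ℝ)
    (θ : Fin d → ℝ) (σ : ℝ≥0) : Matrix (Fin d) (Fin d) ℝ :=
  (information e S fun i => gaussianWeight (e i) S θ σ)⁻¹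

/-- The asymptotic covariance
`C(W) = (∑ᵢ Tᵢᵀ Wᵢ Tᵢ)⁻¹ (∑ᵢ Tᵢᵀ Wᵢ (Wᵢᵍ)⁻¹ Wᵢ Tᵢ) (∑ᵢ Tᵢᵀ Wᵢ Tᵢ)⁻¹`. -/
def aggregateCov (e : ∀ i, Fin (p i) ⊕ Fin (q i) ≃ Fin d) (S : Matrix (Fin d) (Fin d) ℝ)
    (θ : Fin d → ℝ) (σ : ℝ≥0) (W : ∀ i, Matrix (Fin (p i)) (Fin (p i)) ℝ) :
    Matrix (Fin d) (Fin d) ℝ :=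
  (information e S W)⁻¹ *
    (∑ i, (transfer (e i) S)ᵀ * W i * (gaussianWeight (e i) S θ σ)⁻¹ * W i * transfer (e i) S) *
    (information e S W)⁻¹

/-- `est` is the aggregated estimator for the (possibly data-dependent) weights `W n ω` and the
local estimates `b n ω`: a sequence of random vectors that minimizes the weighted risk whenever
the weights are positive definite.  Degenerate weights, for which the estimator is not defined,
impose no condition. -/
structure IsAggregate {Ω : Type*} [MeasurableSpace Ω] (P : Measure Ω)
    (e : ∀ i, Fin (p i) ⊕ Fin (q i) ≃ Fin d) (S : Matrix (Fin d) (Fin d) ℝ)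
    (W : ℕ → Ω → ∀ i, Matrix (Fin (p i)) (Fin (p i)) ℝ)
    (b : ℕ → Ω → ∀ i, Fin (p i) → ℝ) (est : ℕ → Ω → Fin d → ℝ) : Prop where
  aemeasurable : ∀ n, AEMeasurable (est n) P
  minimizes : ∀ n, ∀ᵐ ω ∂P, (∀ i, (W n ω i).PosDef) →
    IsRiskMinimizer e S (W n ω) (b n ω) (est n ω)

end Aggregation

end Collab

end

/-!
Given the observed features of an agent, the label is a linear function of them plus a residual
that is independent of them and has variance `‖θ₋‖²_{Γ₋} + σ²`.  By the law of large numbers the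
training error converges to this variance, and by the central limit theorem and Slutsky's theorem
the least squares error of the agent is asymptotically `N(0, (Wᵢᵍ)⁻¹)`.  The agents are
independent, so their stacked errors are asymptotically normal with block diagonal covariance.

With the `Tᵢ` stacked into one matrix `T` and the `Wᵢ` into one block diagonal matrix `W`, the
aggregate is the weighted least squares estimate `(Tᵀ W T)⁻¹ Tᵀ W b`, and it depends continuously
on `W`.  Slutsky's theorem therefore gives the sandwich covariance `C(W)`, for random weights too as
soon as they converge to `W`.  Optimality of `Wᵍ` is the Gauss–Markov theorem: weighting by
the inverse of the error covariance minimizes the covariance of the estimate.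
-/

noncomputable section

namespace Collab

section WeightedLeastSquares

variable {ι κ : Type*} [Fintype ι] [DecidableEq ι] [Fintype κ]

/-- The matrix of weighted least squares: `b ↦ argmin_t ‖T t - b‖²_W`. -/
def wlsMatrix (T : Matrix κ ι ℝ) (W : Matrix κ κ ℝ) : Matrix ι κ ℝ :=
  (Tᵀ * W * T)⁻¹ * Tᵀ * W

variable {T : Matrix κ ι ℝ} {W : Matrix κ κ ℝ}

lemma wlsMatrix_mul_self (hT : IsUnit (Tᵀ * W * T).det) : wlsMatrix T W * T = 1 := by
  rw [wlsMatrix, Matrix.mul_assoc _ Tᵀ W, Matrix.mul_assoc, nonsing_inv_mul _ hT]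

lemma wlsMatrix_mulVec_sub (hT : IsUnit (Tᵀ * W * T).det) (b : κ → ℝ) (t : ι → ℝ) :
    wlsMatrix T W *ᵥ b - t = wlsMatrix T W *ᵥ (b - T *ᵥ t) := by
  rw [mulVec_sub, mulVec_mulVec, wlsMatrix_mul_self hT, one_mulVec]

lemma normalEquation_wlsMatrix (hT : IsUnit (Tᵀ * W * T).det) (b : κ → ℝ) :
    Tᵀ *ᵥ (W *ᵥ (T *ᵥ (wlsMatrix T W *ᵥ b) - b)) = 0 := by
  simp only [mulVec_sub, mulVec_mulVec, wlsMatrix, ← Matrix.mul_assoc]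
  rw [mul_nonsing_inv _ hT, Matrix.one_mul, sub_self]

lemma add_dotProduct_mulVec_add (hW : W.IsHermitian) (u v : κ → ℝ) :
    (u + v) ⬝ᵥ (W *ᵥ (u + v)) = u ⬝ᵥ (W *ᵥ u) + 2 * (u ⬝ᵥ (W *ᵥ v)) + v ⬝ᵥ (W *ᵥ v) := by
  have hWt : Wᵀ = W := by simpa using hW.eq
  have hsymm : v ⬝ᵥ (W *ᵥ u) = u ⬝ᵥ (W *ᵥ v) := by
    rw [dotProduct_mulVec, dotProduct_comm, ← mulVec_transpose, hWt]
  simp only [mulVec_add, dotProduct_add, add_dotProduct, hsymm]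
  ring

lemma residual_dotProduct_mulVec_residual_eq_add (hW : W.IsHermitian)
    (hT : IsUnit (Tᵀ * W * T).det) (b : κ → ℝ) (t : ι → ℝ) :
    (T *ᵥ t - b) ⬝ᵥ (W *ᵥ (T *ᵥ t - b)) =
      (t - wlsMatrix T W *ᵥ b) ⬝ᵥ ((Tᵀ * W * T) *ᵥ (t - wlsMatrix T W *ᵥ b)) +
      (T *ᵥ (wlsMatrix T W *ᵥ b) - b) ⬝ᵥ (W *ᵥ (T *ᵥ (wlsMatrix T W *ᵥ b) - b)) := by
  set s := wlsMatrix T W *ᵥ b with hs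
  have hsplit : T *ᵥ t - b = T *ᵥ (t - s) + (T *ᵥ s - b) := by rw [mulVec_sub]; abel
  have horth : T *ᵥ (t - s) ⬝ᵥ (W *ᵥ (T *ᵥ s - b)) = 0 := by
    rw [← vecMul_transpose, ← dotProduct_mulVec, hs, normalEquation_wlsMatrix hT, dotProduct_zero]
  rw [hsplit, add_dotProduct_mulVec_add hW, horth, mul_zero, add_zero, ← mulVec_mulVec,
    ← mulVec_mulVec, dotProduct_mulVec _ Tᵀ, vecMul_transpose]

lemma forall_residual_le_iff_eq_wlsMatrix_mulVec (hW : W.IsHermitian) (hT : (Tᵀ * W * T).PosDef)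
    (b : κ → ℝ) (t : ι → ℝ) :
    (∀ u, (T *ᵥ t - b) ⬝ᵥ (W *ᵥ (T *ᵥ t - b)) ≤ (T *ᵥ u - b) ⬝ᵥ (W *ᵥ (T *ᵥ u - b))) ↔
      t = wlsMatrix T W *ᵥ b := by
  have hsplit := residual_dotProduct_mulVec_residual_eq_add hW hT.det_pos.ne'.isUnit b
  constructor
  · intro hmin
    by_contra hne
    have hlt := hT.dotProduct_mulVec_pos (sub_ne_zero.2 hne)
    have hle := hmin (wlsMatrix T W *ᵥ b)
    rw [star_trivial] at hlt
    linarith [hsplit t]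
  · rintro rfl u
    have hnonneg := hT.posSemidef.dotProduct_mulVec_nonneg (u - wlsMatrix T W *ᵥ b)
    rw [star_trivial] at hnonneg
    linarith [hsplit u]

variable [DecidableEq κ] {G : Matrix κ κ ℝ}

lemma wlsMatrix_mul_inv (hG : IsUnit G.det) :
    wlsMatrix T G * G⁻¹ = (Tᵀ * G * T)⁻¹ * Tᵀ := by
  rw [wlsMatrix, Matrix.mul_assoc, mul_nonsing_inv _ hG, Matrix.mul_one]

lemma wlsMatrix_mul_inv_mul_transpose (hG : IsUnit G.det) (hT : IsUnit (Tᵀ * G * T).det) :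
    wlsMatrix T G * G⁻¹ * (wlsMatrix T G)ᵀ = (Tᵀ * G * T)⁻¹ := by
  rw [wlsMatrix_mul_inv hG, Matrix.mul_assoc, ← transpose_mul, wlsMatrix_mul_self hT,
    transpose_one, Matrix.mul_one]

-- The difference is the covariance `(1 - T B) G⁻¹ (1 - T B)ᵀ`, `B = wlsMatrix T G`, of the
-- weighted least squares residual of data with covariance `G⁻¹`.
lemma posSemidef_inv_sub_mul_inv_mul_transpose (hG : G.PosDef)
    (hT : IsUnit (Tᵀ * G * T).det) :
    (G⁻¹ - T * (Tᵀ * G * T)⁻¹ * Tᵀ).PosSemidef := by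
  have hunit := hG.det_pos.ne'.isUnit
  set B := wlsMatrix T G
  set C := (Tᵀ * G * T)⁻¹ with hC
  have hGt : G⁻¹ᵀ = G⁻¹ := by simpa using hG.inv.isHermitian.eq
  have hBG : B * G⁻¹ = C * Tᵀ := wlsMatrix_mul_inv hunit
  have hCt : Cᵀ = C := by
    rw [hC, ← wlsMatrix_mul_inv_mul_transpose hunit hT]
    simp only [transpose_mul, transpose_transpose, hGt, Matrix.mul_assoc]
  have hGB : G⁻¹ * Bᵀ = T * C := by
    rw [← hGt, ← transpose_mul, hBG, transpose_mul, transpose_transpose, hCt]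
  have hBGB : B * G⁻¹ * Bᵀ = C := wlsMatrix_mul_inv_mul_transpose hunit hT
  have hfactor : G⁻¹ - T * C * Tᵀ = (1 - T * B) * G⁻¹ * (1 - T * B)ᴴ := by
    calc G⁻¹ - T * C * Tᵀ
        = G⁻¹ - T * (B * G⁻¹) - G⁻¹ * Bᵀ * Tᵀ + T * (B * G⁻¹ * Bᵀ) * Tᵀ := by
          rw [hBGB, hBG, hGB]
          simp only [← Matrix.mul_assoc]
          abel
      _ = (1 - T * B) * G⁻¹ * (1 - T * B)ᴴ := by
          simp only [conjTranspose_eq_transpose_of_trivial, transpose_sub, transpose_one,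
            transpose_mul, Matrix.sub_mul, Matrix.mul_sub, Matrix.one_mul, Matrix.mul_one,
            Matrix.mul_assoc]
          abel
  rw [hfactor]
  exact hG.inv.posSemidef.mul_mul_conjTranspose_same _

theorem gauss_markov (hG : G.PosDef) (hT : IsUnit (Tᵀ * G * T).det) {L : Matrix ι κ ℝ}
    (hL : L * T = 1) : (L * G⁻¹ * Lᵀ - (Tᵀ * G * T)⁻¹).PosSemidef := by
  have hconj := (posSemidef_inv_sub_mul_inv_mul_transpose hG hT).mul_mul_conjTranspose_same L
  set C := (Tᵀ * G * T)⁻¹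
  have hLt : Tᵀ * Lᵀ = 1 := by rw [← transpose_mul, hL, transpose_one]
  have hcollapse : L * (T * C * Tᵀ) * Lᵀ = C := by
    calc L * (T * C * Tᵀ) * Lᵀ = (L * T) * C * (Tᵀ * Lᵀ) := by simp only [Matrix.mul_assoc]
      _ = C := by rw [hL, hLt, Matrix.one_mul, Matrix.mul_one]
  rwa [conjTranspose_eq_transpose_of_trivial, Matrix.mul_sub, Matrix.sub_mul, hcollapse] at hconj

end WeightedLeastSquares

section Stacking

variable {I ι : Type*} {κ : I → Type*}

/-- The block column with blocks `A i`, used to write the `m` local regressions as a single one. -/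
def stackRows (A : ∀ i, Matrix (κ i) ι ℝ) : Matrix (Σ i, κ i) ι ℝ :=
  Matrix.of fun k => A k.1 k.2

variable [Fintype I] [∀ i, Fintype (κ i)]

lemma uncurry_dotProduct_uncurry (u v : ∀ i, κ i → ℝ) :
    Sigma.uncurry u ⬝ᵥ Sigma.uncurry v = ∑ i, u i ⬝ᵥ v i := by
  simp only [dotProduct, Fintype.sum_sigma, Sigma.uncurry]

variable [DecidableEq I]

lemma blockDiagonal'_mulVec (D : ∀ i, Matrix (κ i) (κ i) ℝ) (v : ∀ i, κ i → ℝ) :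
    blockDiagonal' D *ᵥ Sigma.uncurry v = Sigma.uncurry fun i => D i *ᵥ v i := by
  ext ⟨i, a⟩
  simp only [mulVec, dotProduct, Fintype.sum_sigma, Sigma.uncurry]
  rw [Finset.sum_eq_single_of_mem i (Finset.mem_univ i)]
  · simp only [blockDiagonal'_apply_eq]
  · exact fun j _ hij => Finset.sum_eq_zero fun b _ => by
      rw [blockDiagonal'_apply_ne D a b hij.symm, zero_mul]

lemma uncurry_dotProduct_blockDiagonal'_mulVec (D : ∀ i, Matrix (κ i) (κ i) ℝ)
    (u v : ∀ i, κ i → ℝ) :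
    Sigma.uncurry u ⬝ᵥ (blockDiagonal' D *ᵥ Sigma.uncurry v) = ∑ i, u i ⬝ᵥ (D i *ᵥ v i) := by
  rw [blockDiagonal'_mulVec, uncurry_dotProduct_uncurry]

lemma stackRows_transpose_mul_blockDiagonal'_mul (A B : ∀ i, Matrix (κ i) ι ℝ)
    (D : ∀ i, Matrix (κ i) (κ i) ℝ) :
    (stackRows A)ᵀ * blockDiagonal' D * stackRows B = ∑ i, (A i)ᵀ * D i * B i := by
  ext k l
  have h := uncurry_dotProduct_blockDiagonal'_mulVec D (fun i a => A i a k) fun i a => B i a l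
  rw [Matrix.mul_assoc, Matrix.sum_apply]
  simp only [Matrix.mul_assoc]
  exact h

lemma inv_blockDiagonal' [∀ i, DecidableEq (κ i)] {D : ∀ i, Matrix (κ i) (κ i) ℝ}
    (hD : ∀ i, IsUnit (D i).det) :
    (blockDiagonal' D)⁻¹ = blockDiagonal' fun i => (D i)⁻¹ :=
  inv_eq_right_inv <| by
    rw [← blockDiagonal'_mul, funext fun i => mul_nonsing_inv (D i) (hD i)]
    exact blockDiagonal'_one

end Stacking

lemma posDef_blockDiagonal' {I : Type*} [Finite I] [DecidableEq I] {κ : I → Type*}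
    [∀ i, Finite (κ i)] {D : ∀ i, Matrix (κ i) (κ i) ℝ} (hD : ∀ i, (D i).PosDef) :
    (blockDiagonal' D).PosDef := by
  have := Fintype.ofFinite I
  have := fun i => Fintype.ofFinite (κ i)
  refine .of_dotProduct_mulVec_pos
    (isHermitian_blockDiagonal'_iff.2 fun i => (hD i).isHermitian) fun v hv => ?_
  obtain ⟨w, rfl⟩ : ∃ w : ∀ i, κ i → ℝ, v = Sigma.uncurry w := ⟨fun i a => v ⟨i, a⟩, rfl⟩
  obtain ⟨⟨i, a⟩, hne⟩ := Function.ne_iff.1 hv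
  rw [star_trivial, uncurry_dotProduct_blockDiagonal'_mulVec]
  refine Finset.sum_pos' (fun j _ => ?_) ⟨i, Finset.mem_univ i, ?_⟩
  · simpa using (hD j).posSemidef.dotProduct_mulVec_nonneg (w j)
  · simpa using (hD i).dotProduct_mulVec_pos fun h => hne (congrFun h a)

section OneAgentAlgebra

variable {p q d : ℕ}

lemma dotProduct_eq_obs_add_unobs (e : Fin p ⊕ Fin q ≃ Fin d) (u v : Fin d → ℝ) :
    u ⬝ᵥ v = obs e u ⬝ᵥ obs e v + unobs e u ⬝ᵥ unobs e v := by
  simp only [dotProduct, obs, unobs]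
  rw [← Equiv.sum_comp e, Fintype.sum_sum_type]

lemma obs_mulVec (e : Fin p ⊕ Fin q ≃ Fin d) (S : Matrix (Fin d) (Fin d) ℝ) (t : Fin d → ℝ) :
    obs e (S *ᵥ t) = blockPP e S *ᵥ obs e t + blockPM e S *ᵥ unobs e t := by
  ext a
  exact dotProduct_eq_obs_add_unobs e _ t

lemma unobs_mulVec (e : Fin p ⊕ Fin q ≃ Fin d) (S : Matrix (Fin d) (Fin d) ℝ) (t : Fin d → ℝ) :
    unobs e (S *ᵥ t) = blockMP e S *ᵥ obs e t + blockMM e S *ᵥ unobs e t := by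
  ext a
  exact dotProduct_eq_obs_add_unobs e _ t

lemma transfer_mulVec (e : Fin p ⊕ Fin q ≃ Fin d) (S : Matrix (Fin d) (Fin d) ℝ)
    (t : Fin d → ℝ) :
    transfer e S *ᵥ t = obs e t + ((blockPP e S)⁻¹ * blockPM e S) *ᵥ unobs e t := by
  ext a
  simp only [transfer, mulVec, Pi.add_apply]
  rw [dotProduct_eq_obs_add_unobs e]
  congr 1
  · simp [obs, dotProduct, Matrix.one_apply]
  · simp [unobs, dotProduct]

lemma posDef_blockPP (e : Fin p ⊕ Fin q ≃ Fin d) {S : Matrix (Fin d) (Fin d) ℝ}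
    (hS : S.PosDef) : (blockPP e S).PosDef :=
  hS.submatrix fun _ _ h => Sum.inl_injective (e.injective h)

lemma blockPP_mulVec_transfer_mulVec (e : Fin p ⊕ Fin q ≃ Fin d)
    {S : Matrix (Fin d) (Fin d) ℝ} (hS : IsUnit (blockPP e S).det) (t : Fin d → ℝ) :
    blockPP e S *ᵥ (transfer e S *ᵥ t) = obs e (S *ᵥ t) := by
  rw [transfer_mulVec, obs_mulVec, mulVec_add, mulVec_mulVec, ← Matrix.mul_assoc,
    mul_nonsing_inv _ hS, Matrix.one_mul]

/-- The coefficient vector of the residual of `⟨v, θ⟩` after its population regression on the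
observed part `v₊`. -/
def residualDirection (e : Fin p ⊕ Fin q ≃ Fin d) (S : Matrix (Fin d) (Fin d) ℝ)
    (θ : Fin d → ℝ) : Fin d → ℝ :=
  fun k => Sum.elim (-(((blockPP e S)⁻¹ * blockPM e S) *ᵥ unobs e θ)) (unobs e θ) (e.symm k)

lemma obs_residualDirection (e : Fin p ⊕ Fin q ≃ Fin d) (S : Matrix (Fin d) (Fin d) ℝ)
    (θ : Fin d → ℝ) :
    obs e (residualDirection e S θ) = -(((blockPP e S)⁻¹ * blockPM e S) *ᵥ unobs e θ) := by
  ext a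
  simp [obs, residualDirection]

lemma unobs_residualDirection (e : Fin p ⊕ Fin q ≃ Fin d) (S : Matrix (Fin d) (Fin d) ℝ)
    (θ : Fin d → ℝ) : unobs e (residualDirection e S θ) = unobs e θ := by
  ext a
  simp [unobs, residualDirection]

lemma dotProduct_eq_transfer_add_residual (e : Fin p ⊕ Fin q ≃ Fin d)
    (S : Matrix (Fin d) (Fin d) ℝ) (θ v : Fin d → ℝ) :
    v ⬝ᵥ θ = obs e v ⬝ᵥ (transfer e S *ᵥ θ) + v ⬝ᵥ residualDirection e S θ := by
  rw [dotProduct_eq_obs_add_unobs e v θ, dotProduct_eq_obs_add_unobs e v (residualDirection e S θ),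
    obs_residualDirection, unobs_residualDirection, transfer_mulVec, dotProduct_add,
    dotProduct_neg]
  ring

lemma obs_mulVec_residualDirection (e : Fin p ⊕ Fin q ≃ Fin d)
    {S : Matrix (Fin d) (Fin d) ℝ} (hS : IsUnit (blockPP e S).det) (θ : Fin d → ℝ) :
    obs e (S *ᵥ residualDirection e S θ) = 0 := by
  rw [obs_mulVec, obs_residualDirection, unobs_residualDirection, mulVec_neg, mulVec_mulVec,
    ← Matrix.mul_assoc, mul_nonsing_inv _ hS, Matrix.one_mul, neg_add_cancel]

lemma quad_residualDirection (e : Fin p ⊕ Fin q ≃ Fin d)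
    {S : Matrix (Fin d) (Fin d) ℝ} (hS : IsUnit (blockPP e S).det) (θ : Fin d → ℝ) :
    quad S (residualDirection e S θ) = quad (schur e S) (unobs e θ) := by
  rw [quad, quad, dotProduct_eq_obs_add_unobs e, obs_mulVec_residualDirection e hS, dotProduct_zero,
    zero_add, unobs_residualDirection, unobs_mulVec, obs_residualDirection,
    unobs_residualDirection, schur, sub_mulVec, mulVec_neg, mulVec_mulVec, Matrix.mul_assoc]
  congr 1
  abel

lemma posDef_gaussianWeight (e : Fin p ⊕ Fin q ≃ Fin d) {S : Matrix (Fin d) (Fin d) ℝ}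
    (hS : S.PosDef) {θ : Fin d → ℝ} {σ : ℝ≥0} (hpos : 0 < residualVariance e S θ σ) :
    (gaussianWeight e S θ σ).PosDef :=
  (posDef_blockPP e hS).smul (inv_pos.2 hpos)

lemma inv_gaussianWeight (e : Fin p ⊕ Fin q ≃ Fin d) {S : Matrix (Fin d) (Fin d) ℝ}
    (hS : IsUnit (blockPP e S).det) {θ : Fin d → ℝ} {σ : ℝ≥0}
    (hpos : residualVariance e S θ σ ≠ 0) :
    (gaussianWeight e S θ σ)⁻¹ = residualVariance e S θ σ • (blockPP e S)⁻¹ := by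
  refine inv_eq_right_inv ?_
  rw [gaussianWeight, smul_mul_smul_comm, inv_mul_cancel₀ hpos, mul_nonsing_inv _ hS, one_smul]

end OneAgentAlgebra

section AggregationAlgebra

variable {m d : ℕ} {p q : Fin m → ℕ}

/-- The block column of the matrices `Tᵢ`.  All agents together observe
`stackedTransfer e S *ᵥ θ` up to noise. -/
def stackedTransfer (e : ∀ i, Fin (p i) ⊕ Fin (q i) ≃ Fin d) (S : Matrix (Fin d) (Fin d) ℝ) :
    Matrix (Σ i, Fin (p i)) (Fin d) ℝ :=
  stackRows fun i => transfer (e i) S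

variable {e : ∀ i, Fin (p i) ⊕ Fin (q i) ≃ Fin d} {S : Matrix (Fin d) (Fin d) ℝ}

lemma injective_stackedTransfer_mulVec (hcover : ∀ k, ∃ i a, e i (Sum.inl a) = k)
    (hS : S.PosDef) : Function.Injective (stackedTransfer e S).mulVec := by
  refine (injective_iff_map_eq_zero (stackedTransfer e S).mulVecLin).2 fun v hv => ?_
  refine mulVec_injective_iff_isUnit.2 hS.isUnit ?_
  rw [mulVec_zero]
  ext k
  obtain ⟨i, a, rfl⟩ := hcover k
  have htransfer : transfer (e i) S *ᵥ v = 0 := funext fun a => congrFun hv ⟨i, a⟩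
  have hobs := blockPP_mulVec_transfer_mulVec (e i) (posDef_blockPP (e i) hS).det_pos.ne'.isUnit v
  rw [htransfer, mulVec_zero] at hobs
  exact (congrFun hobs a).symm

lemma stackedTransfer_mul_blockDiagonal'_mul_self
    (W : ∀ i, Matrix (Fin (p i)) (Fin (p i)) ℝ) :
    (stackedTransfer e S)ᵀ * blockDiagonal' W * stackedTransfer e S = information e S W :=
  stackRows_transpose_mul_blockDiagonal'_mul _ _ W

lemma posDef_information (hcover : ∀ k, ∃ i a, e i (Sum.inl a) = k) (hS : S.PosDef)
    {W : ∀ i, Matrix (Fin (p i)) (Fin (p i)) ℝ} (hW : ∀ i, (W i).PosDef) :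
    (information e S W).PosDef := by
  rw [← stackedTransfer_mul_blockDiagonal'_mul_self, ← conjTranspose_eq_transpose_of_trivial]
  exact (posDef_blockDiagonal' hW).conjTranspose_mul_mul_same
    (injective_stackedTransfer_mulVec hcover hS)

lemma isUnit_det_stackedTransfer (hcover : ∀ k, ∃ i a, e i (Sum.inl a) = k) (hS : S.PosDef)
    {W : ∀ i, Matrix (Fin (p i)) (Fin (p i)) ℝ} (hW : ∀ i, (W i).PosDef) :
    IsUnit ((stackedTransfer e S)ᵀ * blockDiagonal' W * stackedTransfer e S).det := by
  rw [stackedTransfer_mul_blockDiagonal'_mul_self]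
  exact (posDef_information hcover hS hW).det_pos.ne'.isUnit

lemma weightedRisk_eq_stacked (W : ∀ i, Matrix (Fin (p i)) (Fin (p i)) ℝ)
    (b : ∀ i, Fin (p i) → ℝ) (t : Fin d → ℝ) :
    weightedRisk e S W b t = (stackedTransfer e S *ᵥ t - Sigma.uncurry b) ⬝ᵥ
      (blockDiagonal' W *ᵥ (stackedTransfer e S *ᵥ t - Sigma.uncurry b)) := by
  have hresidual : stackedTransfer e S *ᵥ t - Sigma.uncurry b =
      Sigma.uncurry fun i => transfer (e i) S *ᵥ t - b i := rfl
  rw [hresidual, uncurry_dotProduct_blockDiagonal'_mulVec]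
  simp only [weightedRisk, quad, transfer_mulVec]

lemma isRiskMinimizer_iff_eq_wlsMatrix_mulVec (hcover : ∀ k, ∃ i a, e i (Sum.inl a) = k)
    (hS : S.PosDef) {W : ∀ i, Matrix (Fin (p i)) (Fin (p i)) ℝ} (hW : ∀ i, (W i).PosDef)
    {b : ∀ i, Fin (p i) → ℝ} {t : Fin d → ℝ} :
    IsRiskMinimizer e S W b t ↔
      t = wlsMatrix (stackedTransfer e S) (blockDiagonal' W) *ᵥ Sigma.uncurry b := by
  simp only [IsRiskMinimizer, weightedRisk_eq_stacked]
  refine forall_residual_le_iff_eq_wlsMatrix_mulVec (posDef_blockDiagonal' hW).isHermitian ?_ _ _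
  rw [stackedTransfer_mul_blockDiagonal'_mul_self]
  exact posDef_information hcover hS hW

lemma existsUnique_isRiskMinimizer (hcover : ∀ k, ∃ i a, e i (Sum.inl a) = k) (hS : S.PosDef)
    {W : ∀ i, Matrix (Fin (p i)) (Fin (p i)) ℝ} (hW : ∀ i, (W i).PosDef)
    (b : ∀ i, Fin (p i) → ℝ) : ∃! t, IsRiskMinimizer e S W b t := by
  simp only [isRiskMinimizer_iff_eq_wlsMatrix_mulVec hcover hS hW, existsUnique_eq]

variable {θ : Fin d → ℝ} {σ : ℝ≥0}

/-- The joint asymptotic covariance of the local least squares estimates: agents are independent,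
so it is block diagonal. -/
def stackedCov (e : ∀ i, Fin (p i) ⊕ Fin (q i) ≃ Fin d) (S : Matrix (Fin d) (Fin d) ℝ)
    (θ : Fin d → ℝ) (σ : ℝ≥0) : Matrix (Σ i, Fin (p i)) (Σ i, Fin (p i)) ℝ :=
  blockDiagonal' fun i => (gaussianWeight (e i) S θ σ)⁻¹

lemma inv_blockDiagonal'_gaussianWeight (hS : S.PosDef)
    (hpos : ∀ i, 0 < residualVariance (e i) S θ σ) :
    (blockDiagonal' fun i => gaussianWeight (e i) S θ σ)⁻¹ = stackedCov e S θ σ :=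
  inv_blockDiagonal' fun i => (posDef_gaussianWeight (e i) hS (hpos i)).det_pos.ne'.isUnit

lemma aggregateCov_eq_wlsMatrix_mul {W : ∀ i, Matrix (Fin (p i)) (Fin (p i)) ℝ}
    (hW : ∀ i, (W i).IsHermitian) :
    aggregateCov e S θ σ W = wlsMatrix (stackedTransfer e S) (blockDiagonal' W) *
      stackedCov e S θ σ * (wlsMatrix (stackedTransfer e S) (blockDiagonal' W))ᵀ := by
  have hWt : (blockDiagonal' W)ᵀ = blockDiagonal' W := by
    simpa using (isHermitian_blockDiagonal'_iff.2 hW).eq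
  have hmiddle : (stackedTransfer e S)ᵀ *
      (blockDiagonal' W * stackedCov e S θ σ * blockDiagonal' W) * stackedTransfer e S =
      ∑ i, (transfer (e i) S)ᵀ * W i * (gaussianWeight (e i) S θ σ)⁻¹ * W i *
        transfer (e i) S := by
    rw [stackedCov, ← blockDiagonal'_mul, ← blockDiagonal'_mul, stackedTransfer,
      stackRows_transpose_mul_blockDiagonal'_mul]
    simp only [Matrix.mul_assoc]
  rw [aggregateCov, ← hmiddle, wlsMatrix, stackedTransfer_mul_blockDiagonal'_mul_self]
  have hinf : (information e S W)ᵀ = information e S W := by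
    rw [← stackedTransfer_mul_blockDiagonal'_mul_self]
    simp only [transpose_mul, transpose_transpose, hWt, Matrix.mul_assoc]
  simp only [transpose_mul, transpose_transpose, transpose_nonsing_inv, hWt, hinf,
    Matrix.mul_assoc]

lemma aggregateCov_gaussianWeight (hcover : ∀ k, ∃ i a, e i (Sum.inl a) = k) (hS : S.PosDef)
    (hpos : ∀ i, 0 < residualVariance (e i) S θ σ) :
    aggregateCov e S θ σ (fun i => gaussianWeight (e i) S θ σ) = gaussianCov e S θ σ := by
  have hG (i) := posDef_gaussianWeight (e i) hS (hpos i)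
  rw [aggregateCov_eq_wlsMatrix_mul fun i => (hG i).isHermitian,
    ← inv_blockDiagonal'_gaussianWeight hS hpos,
    wlsMatrix_mul_inv_mul_transpose (posDef_blockDiagonal' hG).det_pos.ne'.isUnit
      (isUnit_det_stackedTransfer hcover hS hG),
    stackedTransfer_mul_blockDiagonal'_mul_self, gaussianCov]

lemma posSemidef_gaussianCov (hcover : ∀ k, ∃ i a, e i (Sum.inl a) = k) (hS : S.PosDef)
    (hpos : ∀ i, 0 < residualVariance (e i) S θ σ) : (gaussianCov e S θ σ).PosSemidef :=
  (posDef_information hcover hS fun i => posDef_gaussianWeight (e i) hS (hpos i)).inv.posSemidef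

lemma posSemidef_aggregateCov_sub_gaussianCov (hcover : ∀ k, ∃ i a, e i (Sum.inl a) = k)
    (hS : S.PosDef) (hpos : ∀ i, 0 < residualVariance (e i) S θ σ)
    {W : ∀ i, Matrix (Fin (p i)) (Fin (p i)) ℝ} (hW : ∀ i, (W i).PosDef) :
    (aggregateCov e S θ σ W - gaussianCov e S θ σ).PosSemidef := by
  have hG (i) := posDef_gaussianWeight (e i) hS (hpos i)
  rw [aggregateCov_eq_wlsMatrix_mul fun i => (hW i).isHermitian,
    ← inv_blockDiagonal'_gaussianWeight hS hpos, gaussianCov,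
    ← stackedTransfer_mul_blockDiagonal'_mul_self]
  exact gauss_markov (posDef_blockDiagonal' hG) (isUnit_det_stackedTransfer hcover hS hG)
    (wlsMatrix_mul_self (isUnit_det_stackedTransfer hcover hS hW))

lemma posSemidef_inv_gaussianWeight_sub (hcover : ∀ k, ∃ i a, e i (Sum.inl a) = k)
    (hS : S.PosDef) (hpos : ∀ i, 0 < residualVariance (e i) S θ σ) (i : Fin m) :
    ((gaussianWeight (e i) S θ σ)⁻¹ -
      transfer (e i) S * gaussianCov e S θ σ * (transfer (e i) S)ᵀ).PosSemidef := by
  have hG (i) := posDef_gaussianWeight (e i) hS (hpos i)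
  have hstacked := posSemidef_inv_sub_mul_inv_mul_transpose (posDef_blockDiagonal' hG)
    (isUnit_det_stackedTransfer hcover hS hG)
  rw [inv_blockDiagonal'_gaussianWeight hS hpos, stackedTransfer_mul_blockDiagonal'_mul_self]
    at hstacked
  convert hstacked.submatrix (Sigma.mk i) using 1
  ext a b
  simp only [Matrix.sub_apply, submatrix_apply, stackedCov, blockDiagonal'_apply_eq]
  rfl

end AggregationAlgebra

section MatrixAnalysis

variable {ι κ : Type*}

scoped instance : MeasurableSpace (Matrix ι κ ℝ) :=
  inferInstanceAs (MeasurableSpace (ι → κ → ℝ))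

scoped instance [Countable ι] [Countable κ] : BorelSpace (Matrix ι κ ℝ) :=
  inferInstanceAs (BorelSpace (ι → κ → ℝ))

scoped instance [Countable ι] [Countable κ] : SecondCountableTopology (Matrix ι κ ℝ) :=
  inferInstanceAs (SecondCountableTopology (ι → κ → ℝ))

variable [Fintype ι] [DecidableEq ι] [Fintype κ]

lemma measurable_matrix_inv : Measurable fun A : Matrix ι ι ℝ => A⁻¹ := by
  simp only [Matrix.inv_def, Ring.inverse_eq_inv']
  have hdet : Continuous fun A : Matrix ι ι ℝ => A.det := by fun_prop
  have hadj : Continuous fun A : Matrix ι ι ℝ => A.adjugate := by fun_prop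
  exact hdet.measurable.inv.smul hadj.measurable

lemma continuousAt_matrix_inv_of_isUnit_det {A : Matrix ι ι ℝ} (hA : IsUnit A.det) :
    ContinuousAt (fun B : Matrix ι ι ℝ => B⁻¹) A :=
  continuousAt_matrix_inv A (by simpa using continuousAt_inv₀ hA.ne_zero)

lemma measurable_wlsMatrix (T : Matrix κ ι ℝ) : Measurable fun W => wlsMatrix T W := by
  have hgram : Continuous fun W : Matrix κ κ ℝ => Tᵀ * W * T := by fun_prop
  have hmul : Continuous fun z : Matrix ι ι ℝ × Matrix κ κ ℝ => z.1 * Tᵀ * z.2 := by fun_prop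
  simpa only [wlsMatrix, Function.comp_def, id] using
    hmul.measurable.comp ((measurable_matrix_inv.comp hgram.measurable).prodMk measurable_id)

lemma continuousAt_wlsMatrix {T : Matrix κ ι ℝ} {W : Matrix κ κ ℝ}
    (hT : IsUnit (Tᵀ * W * T).det) : ContinuousAt (fun V => wlsMatrix T V) W := by
  have hinv : ContinuousAt (fun V : Matrix κ κ ℝ => (Tᵀ * V * T)⁻¹) W :=
    ContinuousAt.comp' (f := fun V : Matrix κ κ ℝ => Tᵀ * V * T)
      (continuousAt_matrix_inv_of_isUnit_det hT) (by fun_prop)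
  simp only [wlsMatrix]
  fun_prop

end MatrixAnalysis

section Probability

variable {Ω : Type*} [MeasurableSpace Ω] {P : Measure Ω}

lemma tendsto_measure_one_of_ae_eventually [IsProbabilityMeasure P] {A : ℕ → Set Ω}
    (h : ∀ᵐ ω ∂P, ∀ᶠ n in atTop, ω ∈ A n) : Tendsto (fun n => P (A n)) atTop (𝓝 1) := by
  set B : ℕ → Set Ω := fun N => {ω | ∀ n, N ≤ n → ω ∈ A n}
  have hmono : Monotone B := fun N N' hNN' ω hω n hn => hω n (hNN'.trans hn)
  have hunion : P (⋃ N, B N) = 1 := by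
    rw [← measure_univ (μ := P)]
    refine measure_congr ?_
    filter_upwards [h] with ω hω
    obtain ⟨N, hN⟩ := eventually_atTop.1 hω
    exact propext ⟨fun _ => trivial, fun _ => Set.mem_iUnion.2 ⟨N, hN⟩⟩
  have hlim := tendsto_measure_iUnion_atTop (μ := P) hmono
  rw [hunion] at hlim
  exact tendsto_of_tendsto_of_tendsto_of_le_of_le hlim tendsto_const_nhds
    (fun n => measure_mono fun ω hω => hω n le_rfl) fun n => prob_le_one

lemma tendsto_average_ae {𝓧 : Type*} [MeasurableSpace 𝓧] {X : ℕ → Ω → 𝓧}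
    (hindep : Pairwise fun j k => IndepFun (X j) (X k) P)
    (hident : ∀ j, IdentDistrib (X j) (X 0) P P) {f : 𝓧 → ℝ} (hf : Measurable f)
    (hint : Integrable (fun ω => f (X 0 ω)) P) :
    ∀ᵐ ω ∂P, Tendsto (fun n : ℕ => (n : ℝ)⁻¹ * ∑ j ∈ Finset.range n, f (X j ω)) atTop
      (𝓝 (∫ ω, f (X 0 ω) ∂P)) := by
  have h := strong_law_ae_real (fun j ω => f (X j ω)) hint
    (fun j k hjk => (hindep hjk).comp hf hf) fun j => (hident j).comp hf
  simpa only [div_eq_inv_mul] using h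

lemma iIndepFun_curry [IsProbabilityMeasure P] {ι κ 𝓧 : Type*} [Countable ι] [Countable κ]
    [MeasurableSpace 𝓧] {X : ι → κ → Ω → 𝓧} (hX : ∀ i j, AEMeasurable (X i j) P)
    (h : iIndepFun (fun (s : ι × κ) => X s.1 s.2) P) :
    iIndepFun (fun i ω j => X i j ω) P := by
  have hprob (i j) : IsProbabilityMeasure (P.map (X i j)) :=
    Measure.isProbabilityMeasure_map (hX i j)
  have hrow (i) : iIndepFun (X i) P := h.precomp (g := fun j => (i, j)) fun _ _ => by simp
  have hlaw := h.map_fun_eq_infinitePi_map₀' fun s : ι × κ => hX s.1 s.2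
  rw [iIndepFun_iff_map_fun_eq_infinitePi_map₀' fun i => aemeasurable_pi_lambda _ (hX i)]
  have hcomp : (fun ω i j => X i j ω) =
      MeasurableEquiv.curry ι κ 𝓧 ∘ fun ω (s : ι × κ) => X s.1 s.2 ω := rfl
  rw [hcomp, ← AEMeasurable.map_map_of_aemeasurable
    (MeasurableEquiv.curry ι κ 𝓧).measurable.aemeasurable
    (aemeasurable_pi_lambda _ fun s => hX s.1 s.2), hlaw,
    Measure.infinitePi_map_curry (fun i j => P.map (X i j))]
  congr 1
  funext i
  exact ((hrow i).map_fun_eq_infinitePi_map₀' (hX i)).symm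

lemma indepFun_prodMk_of_prodMk [IsProbabilityMeasure P] {𝓧 𝓨 𝓩 : Type*}
    [MeasurableSpace 𝓧] [MeasurableSpace 𝓨] [MeasurableSpace 𝓩]
    {X : Ω → 𝓧} {Y : Ω → 𝓨} {Z : Ω → 𝓩} (hX : AEMeasurable X P) (hY : AEMeasurable Y P)
    (hZ : AEMeasurable Z P) (hXY : IndepFun X Y P)
    (hXYZ : IndepFun (fun ω => (X ω, Y ω)) Z P) : IndepFun X (fun ω => (Y ω, Z ω)) P := by
  have hYZ : IndepFun Y Z P := hXYZ.comp measurable_snd measurable_id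
  have hassoc : (fun ω => (X ω, Y ω, Z ω)) =
      MeasurableEquiv.prodAssoc ∘ fun ω => ((X ω, Y ω), Z ω) := rfl
  rw [indepFun_iff_map_prod_eq_prod_map_map hX (hY.prodMk hZ), hassoc,
    ← AEMeasurable.map_map_of_aemeasurable
      MeasurableEquiv.prodAssoc.measurable.aemeasurable ((hX.prodMk hY).prodMk hZ),
    (indepFun_iff_map_prod_eq_prod_map_map (hX.prodMk hY) hZ).1 hXYZ,
    (indepFun_iff_map_prod_eq_prod_map_map hX hY).1 hXY,
    (indepFun_iff_map_prod_eq_prod_map_map hY hZ).1 hYZ]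
  have := Measure.isProbabilityMeasure_map hX
  have := Measure.isProbabilityMeasure_map hY
  have := Measure.isProbabilityMeasure_map hZ
  exact Measure.prodAssoc_prod ..

lemma integral_sum_sq_of_indepFun [IsProbabilityMeasure P] {I : Type*} [Fintype I]
    {X : I → Ω → ℝ} (hL2 : ∀ i, MemLp (X i) 2 P) (hmean : ∀ i, ∫ ω, X i ω ∂P = 0)
    (hindep : Pairwise fun i j => IndepFun (X i) (X j) P) :
    ∫ ω, (∑ i, X i ω) ^ 2 ∂P = ∑ i, ∫ ω, X i ω ^ 2 ∂P := by
  have hmean_sum : ∫ ω, ∑ i, X i ω ∂P = 0 := by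
    rw [integral_finsetSum _ fun i _ => (hL2 i).integrable one_le_two]
    simp only [hmean, Finset.sum_const_zero]
  have hvar := IndepFun.variance_sum (s := Finset.univ) (fun i _ => hL2 i)
    fun i _ j _ hij => hindep hij
  rw [Finset.sum_fn, variance_of_integral_eq_zero
    (memLp_finsetSum _ fun i _ => hL2 i).aemeasurable hmean_sum] at hvar
  rw [hvar]
  exact Finset.sum_congr rfl fun i _ =>
    variance_of_integral_eq_zero (hL2 i).aemeasurable (hmean i)

end Probability

section TendstoGaussian

variable {Ω : Type*} [MeasurableSpace Ω] {P : Measure Ω} [IsProbabilityMeasure P]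
variable {ι κ : Type*} [Fintype ι] [DecidableEq ι] [Fintype κ] [DecidableEq κ]

/-- Convergence in distribution of random vectors to `N(0, C)`.  It extends `TendstoNormal` to
arbitrary finite index types, as needed for the stacked errors of all agents. -/
def TendstoGaussian (P : Measure Ω) [IsProbabilityMeasure P] (Z : ℕ → Ω → ι → ℝ)
    (C : Matrix ι ι ℝ) : Prop :=
  TendstoInDistribution (fun n ω => WithLp.toLp 2 (Z n ω)) atTop
    (id : EuclideanSpace ℝ ι → EuclideanSpace ℝ ι) (fun _ => P) (multivariateGaussian 0 C)

variable {Z : ℕ → Ω → ι → ℝ} {C : Matrix ι ι ℝ}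

lemma map_mulVec_multivariateGaussian (hC : C.PosSemidef) (M : Matrix κ ι ℝ) :
    (multivariateGaussian 0 C).map
      (fun z : EuclideanSpace ℝ ι => (WithLp.toLp 2 (M *ᵥ z.ofLp) : EuclideanSpace ℝ κ)) =
      multivariateGaussian 0 (M * C * Mᵀ) := by
  have hcont : Continuous
      (fun z : EuclideanSpace ℝ ι => (WithLp.toLp 2 (M *ᵥ z.ofLp) : EuclideanSpace ℝ κ)) := by
    fun_prop
  have := Measure.isProbabilityMeasure_map (μ := multivariateGaussian 0 C)
    hcont.measurable.aemeasurable
  have hMC : (M * C * Mᵀ).PosSemidef := by simpa using hC.mul_mul_conjTranspose_same M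
  refine Measure.ext_of_charFun (funext fun t => ?_)
  have hinner (z : EuclideanSpace ℝ ι) :
      inner ℝ (WithLp.toLp 2 (M *ᵥ z.ofLp) : EuclideanSpace ℝ κ) t =
        inner ℝ z (WithLp.toLp 2 (Mᵀ *ᵥ t.ofLp)) := by
    simp only [EuclideanSpace.inner_eq_star_dotProduct, star_trivial]
    rw [dotProduct_mulVec, ← mulVec_transpose, dotProduct_comm, dotProduct_comm z.ofLp]
  rw [charFun_multivariateGaussian hMC, charFun_apply,
    integral_map hcont.measurable.aemeasurable (by fun_prop)]
  simp_rw [hinner]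
  rw [← charFun_apply, charFun_multivariateGaussian hC]
  congr 3
  · simp
  · simp only [mulVec_mulVec, Matrix.mul_assoc]
    rw [← mulVec_mulVec _ M, dotProduct_mulVec t.ofLp M, ← mulVec_transpose]

lemma TendstoGaussian.mulVec_of_tendsto (hC : C.PosSemidef) (hZ : TendstoGaussian P Z C)
    {A : ℕ → Ω → Matrix κ ι ℝ} {M : Matrix κ ι ℝ} (hA : ∀ n, AEMeasurable (A n) P)
    (hAM : ∀ᵐ ω ∂P, Tendsto (fun n => A n ω) atTop (𝓝 M)) :
    TendstoGaussian P (fun n ω => A n ω *ᵥ Z n ω) (M * C * Mᵀ) := by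
  have hmulVec : Continuous (fun x : EuclideanSpace ℝ ι × (κ → ι → ℝ) =>
      (WithLp.toLp 2 (Matrix.of x.2 *ᵥ x.1.ofLp) : EuclideanSpace ℝ κ)) := by
    have : Continuous fun x : EuclideanSpace ℝ ι × (κ → ι → ℝ) => Matrix.of x.2 *ᵥ x.1.ofLp :=
      Continuous.matrix_mulVec continuous_snd (by fun_prop)
    fun_prop
  have hA' (n) : AEMeasurable (fun ω k s => A n ω k s) P := hA n
  have hAM' : ∀ᵐ ω ∂P, Tendsto (fun n k s => A n ω k s) atTop (𝓝 fun k s => M k s) := hAM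
  have hslutsky := TendstoInDistribution.continuous_comp_prodMk_of_tendstoInMeasure_const hmulVec
    hZ (tendstoInMeasure_of_tendsto_ae (fun n => (hA' n).aestronglyMeasurable) hAM') hA'
  refine ⟨hslutsky.forall_aemeasurable, aemeasurable_id, ?_⟩
  have hlimit : ((multivariateGaussian 0 C).map fun z : EuclideanSpace ℝ ι =>
      (WithLp.toLp 2 (Matrix.of M *ᵥ z.ofLp) : EuclideanSpace ℝ κ)) =
      multivariateGaussian 0 (M * C * Mᵀ) := map_mulVec_multivariateGaussian hC M
  have hlim := hslutsky.tendsto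
  simp only [id, hlimit, Measure.map_id] at hlim ⊢
  exact hlim

lemma TendstoGaussian.mulVec (hC : C.PosSemidef) (hZ : TendstoGaussian P Z C)
    (M : Matrix κ ι ℝ) : TendstoGaussian P (fun n ω => M *ᵥ Z n ω) (M * C * Mᵀ) :=
  hZ.mulVec_of_tendsto hC (fun _ => aemeasurable_const) (ae_of_all _ fun _ => tendsto_const_nhds)

lemma TendstoGaussian.congr_ae_eventually (hZ : TendstoGaussian P Z C) {Y : ℕ → Ω → ι → ℝ}
    (hY : ∀ n, AEMeasurable (Y n) P) (hYZ : ∀ᵐ ω ∂P, ∀ᶠ n in atTop, Y n ω = Z n ω) :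
    TendstoGaussian P Y C := by
  have hYm (n) : AEMeasurable (fun ω => (WithLp.toLp 2 (Y n ω) : EuclideanSpace ℝ ι)) P :=
    (WithLp.measurable_toLp 2 _).comp_aemeasurable (hY n)
  refine tendstoInDistribution_of_tendstoInMeasure_sub _ _ hZ
    (tendstoInMeasure_of_tendsto_ae (fun n => ?_) ?_) hYm
  · exact ((hYm n).sub (hZ.forall_aemeasurable n)).aestronglyMeasurable
  · filter_upwards [hYZ] with ω hω
    refine tendsto_const_nhds.congr' ?_
    filter_upwards [hω] with n hn
    simp only [Pi.sub_apply, Pi.zero_apply, hn, sub_self]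

-- Cramér–Wold: the characteristic function at `t` only involves the projection on `t`.
lemma tendstoGaussian_of_forall_dotProduct (hC : C.PosSemidef)
    (hZ : ∀ n, AEMeasurable (Z n) P)
    (h : ∀ t : ι → ℝ, TendstoInDistribution (fun n ω => t ⬝ᵥ Z n ω) atTop id (fun _ => P)
      (gaussianReal 0 (t ⬝ᵥ (C *ᵥ t)).toNNReal)) :
    TendstoGaussian P Z C := by
  have hZm (n) : AEMeasurable (fun ω => (WithLp.toLp 2 (Z n ω) : EuclideanSpace ℝ ι)) P :=
    (WithLp.measurable_toLp 2 _).comp_aemeasurable (hZ n)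
  refine ⟨hZm, aemeasurable_id, ProbabilityMeasure.tendsto_iff_tendsto_charFun.2 fun t => ?_⟩
  have hnonneg : 0 ≤ t.ofLp ⬝ᵥ (C *ᵥ t.ofLp) := by
    simpa using hC.dotProduct_mulVec_nonneg t.ofLp
  have hlim := ProbabilityMeasure.tendsto_iff_tendsto_charFun.1 (h t.ofLp).tendsto 1
  simp only [ProbabilityMeasure.coe_mk, Measure.map_id, charFun_gaussianReal,
    Real.coe_toNNReal _ hnonneg] at hlim
  simp only [ProbabilityMeasure.coe_mk, Measure.map_id, charFun_multivariateGaussian hC]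
  convert hlim using 2 with n
  · rw [charFun_apply, charFun_apply, integral_map (hZm n) (by fun_prop),
      integral_map ((h t.ofLp).forall_aemeasurable n) (by fun_prop)]
    simp [EuclideanSpace.inner_eq_star_dotProduct]
  · simp

theorem tendstoGaussian_inv_sqrt_smul_sum {V : ℕ → Ω → ι → ℝ} (hC : C.PosSemidef)
    (hindep : iIndepFun V P) (hident : ∀ j, IdentDistrib (V j) (V 0) P P)
    (hL2 : ∀ t : ι → ℝ, MemLp (fun ω => t ⬝ᵥ V 0 ω) 2 P)
    (hmean : ∀ t : ι → ℝ, ∫ ω, t ⬝ᵥ V 0 ω ∂P = 0)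
    (hcov : ∀ t : ι → ℝ, ∫ ω, (t ⬝ᵥ V 0 ω) ^ 2 ∂P = t ⬝ᵥ (C *ᵥ t)) :
    TendstoGaussian P (fun n ω => (√(n : ℝ))⁻¹ • ∑ j ∈ Finset.range n, V j ω) C := by
  refine tendstoGaussian_of_forall_dotProduct hC (fun n => ?_) fun t => ?_
  · exact (Finset.aemeasurable_fun_sum _ fun j _ => (hident j).aemeasurable_fst).fun_const_smul _
  have hproj : Measurable fun v : ι → ℝ => t ⬝ᵥ v := by
    have : Continuous fun v : ι → ℝ => t ⬝ᵥ v := by fun_prop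
    exact this.measurable
  have hvar : Var[fun ω => t ⬝ᵥ V 0 ω; P] = t ⬝ᵥ (C *ᵥ t) := by
    rw [variance_of_integral_eq_zero (hL2 t).aemeasurable (hmean t), hcov]
  have hclt := tendstoInDistribution_inv_sqrt_mul_sum_sub (P := P)
    (X := fun j ω => t ⬝ᵥ V j ω) (Y := id)
    (P' := gaussianReal 0 (Var[fun ω => t ⬝ᵥ V 0 ω; P]).toNNReal) ⟨aemeasurable_id, by simp⟩
    (hL2 t) (hindep.comp (fun _ v => t ⬝ᵥ v) fun _ => hproj) fun j => (hident j).comp hproj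
  simpa only [hvar, hmean, mul_zero, sub_zero, dotProduct_smul, dotProduct_sum, smul_eq_mul]
    using hclt

end TendstoGaussian

section RegressionSample

variable {Ω : Type*} [MeasurableSpace Ω] {P : Measure Ω}
variable {ι : Type*} [Fintype ι] [DecidableEq ι] {S : Matrix ι ι ℝ} {σ : ℝ≥0}
variable {x : Ω → EuclideanSpace ℝ ι} {ξ : Ω → ℝ}

lemma hasGaussianLaw_dotProduct_prodMk (hx : HasLaw x (multivariateGaussian 0 S) P)
    (u w : ι → ℝ) :
    HasGaussianLaw (fun ω => ((x ω).ofLp ⬝ᵥ u, (x ω).ofLp ⬝ᵥ w)) P := by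
  have h := hx.hasGaussianLaw.map_fun
    ((innerSL ℝ (WithLp.toLp 2 u)).prod (innerSL ℝ (WithLp.toLp 2 w)))
  simpa [EuclideanSpace.inner_eq_star_dotProduct] using h

lemma memLp_two_dotProduct (hx : HasLaw x (multivariateGaussian 0 S) P) (u : ι → ℝ) :
    MemLp (fun ω => (x ω).ofLp ⬝ᵥ u) 2 P :=
  (hasGaussianLaw_dotProduct_prodMk hx u u).fst.memLp_two

lemma integral_dotProduct_eq_zero (hx : HasLaw x (multivariateGaussian 0 S) P) (u : ι → ℝ) :
    ∫ ω, (x ω).ofLp ⬝ᵥ u ∂P = 0 := by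
  have h := integral_inner (𝕜 := ℝ) hx.hasGaussianLaw.integrable (WithLp.toLp 2 u)
  simpa [EuclideanSpace.inner_eq_star_dotProduct, hx.integral_eq] using h

lemma covariance_dotProduct_dotProduct (hS : S.PosSemidef)
    (hx : HasLaw x (multivariateGaussian 0 S) P) (u w : ι → ℝ) :
    cov[fun ω => (x ω).ofLp ⬝ᵥ u, fun ω => (x ω).ofLp ⬝ᵥ w; P] = u ⬝ᵥ (S *ᵥ w) := by
  have hinner (v : ι → ℝ) (z : EuclideanSpace ℝ ι) :
      z.ofLp ⬝ᵥ v = inner ℝ (WithLp.toLp 2 v) z := by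
    simp [EuclideanSpace.inner_eq_star_dotProduct]
  simp only [hinner]
  rw [hx.covariance_fun_comp (f := fun z => inner ℝ (WithLp.toLp 2 u) z)
    (g := fun z => inner ℝ (WithLp.toLp 2 w) z) (by fun_prop) (by fun_prop),
    ← covarianceBilin_apply_eq_cov IsGaussian.memLp_two_id, covarianceBilin_multivariateGaussian hS]
  exact hinner (S *ᵥ w) (WithLp.toLp 2 u)

lemma integral_dotProduct_mul_dotProduct (hS : S.PosSemidef)
    (hx : HasLaw x (multivariateGaussian 0 S) P) (u w : ι → ℝ) :
    ∫ ω, ((x ω).ofLp ⬝ᵥ u) * ((x ω).ofLp ⬝ᵥ w) ∂P = u ⬝ᵥ (S *ᵥ w) := by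
  have := hx.isProbabilityMeasure
  rw [← covariance_dotProduct_dotProduct hS hx, covariance_eq_sub (memLp_two_dotProduct hx u)
    (memLp_two_dotProduct hx w), integral_dotProduct_eq_zero hx, zero_mul, sub_zero]
  rfl

lemma indepFun_dotProduct_dotProduct (hS : S.PosSemidef)
    (hx : HasLaw x (multivariateGaussian 0 S) P) {u w : ι → ℝ} (huw : u ⬝ᵥ (S *ᵥ w) = 0) :
    IndepFun (fun ω => (x ω).ofLp ⬝ᵥ u) (fun ω => (x ω).ofLp ⬝ᵥ w) P := by
  have := hx.isProbabilityMeasure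
  exact (hasGaussianLaw_dotProduct_prodMk hx u w).indepFun_of_covariance_eq_zero
    ((covariance_dotProduct_dotProduct hS hx u w).trans huw)

/-- One labelled sample of a linear model: a feature vector `x` with law `N(0, S)` and an
independent centred noise `ξ` of variance `σ²`, not necessarily Gaussian. -/
structure IsRegressionSample (P : Measure Ω) (S : Matrix ι ι ℝ) (σ : ℝ≥0)
    (x : Ω → EuclideanSpace ℝ ι) (ξ : Ω → ℝ) : Prop where
  hasLaw_features : HasLaw x (multivariateGaussian 0 S) P
  memLp_noise : MemLp ξ 2 P
  integral_noise : ∫ ω, ξ ω ∂P = 0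
  integral_noise_sq : ∫ ω, ξ ω ^ 2 ∂P = (σ : ℝ) ^ 2
  indepFun : IndepFun x ξ P

lemma isRegressionSample_of_hasLaw_gaussianReal (hx : HasLaw x (multivariateGaussian 0 S) P)
    (hξ : HasLaw ξ (gaussianReal 0 (σ ^ 2)) P) (hxξ : IndepFun x ξ P) :
    IsRegressionSample P S σ x ξ where
  hasLaw_features := hx
  memLp_noise := hξ.hasGaussianLaw.memLp_two
  integral_noise := by rw [hξ.integral_eq, integral_id_gaussianReal]
  integral_noise_sq := by
    rw [← variance_of_integral_eq_zero hξ.aemeasurable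
      (by rw [hξ.integral_eq, integral_id_gaussianReal]), hξ.variance_eq, variance_id_gaussianReal]
    simp
  indepFun := hxξ

namespace IsRegressionSample

variable (h : IsRegressionSample P S σ x ξ)

include h

lemma memLp_dotProduct_add_noise (w : ι → ℝ) :
    MemLp (fun ω => (x ω).ofLp ⬝ᵥ w + ξ ω) 2 P :=
  (memLp_two_dotProduct h.hasLaw_features w).add h.memLp_noise

lemma integral_dotProduct_add_noise_sq (hS : S.PosSemidef) (w : ι → ℝ) :
    ∫ ω, ((x ω).ofLp ⬝ᵥ w + ξ ω) ^ 2 ∂P = w ⬝ᵥ (S *ᵥ w) + (σ : ℝ) ^ 2 := by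
  have := h.hasLaw_features.isProbabilityMeasure
  have hx := memLp_two_dotProduct h.hasLaw_features w
  have hx_mean := integral_dotProduct_eq_zero h.hasLaw_features w
  have hproj : Measurable fun z : EuclideanSpace ℝ ι => z.ofLp ⬝ᵥ w :=
    Continuous.measurable (by fun_prop)
  have hind : IndepFun (fun ω => (x ω).ofLp ⬝ᵥ w) ξ P := h.indepFun.comp hproj measurable_id
  have hmean : ∫ ω, ((x ω).ofLp ⬝ᵥ w + ξ ω) ∂P = 0 := by
    rw [integral_add (hx.integrable one_le_two) (h.memLp_noise.integrable one_le_two), hx_mean,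
      h.integral_noise, add_zero]
  rw [← variance_of_integral_eq_zero (h.memLp_dotProduct_add_noise w).aemeasurable hmean,
    hind.variance_fun_add hx h.memLp_noise, variance_of_integral_eq_zero hx.aemeasurable hx_mean,
    variance_of_integral_eq_zero h.memLp_noise.aemeasurable h.integral_noise, h.integral_noise_sq,
    ← integral_dotProduct_mul_dotProduct hS h.hasLaw_features]
  simp only [sq]

lemma indepFun_dotProduct_add_noise (hS : S.PosSemidef) {u w : ι → ℝ}
    (huw : u ⬝ᵥ (S *ᵥ w) = 0) :
    IndepFun (fun ω => (x ω).ofLp ⬝ᵥ u) (fun ω => (x ω).ofLp ⬝ᵥ w + ξ ω) P := by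
  have := h.hasLaw_features.isProbabilityMeasure
  have hproj : Measurable fun z : EuclideanSpace ℝ ι => (z.ofLp ⬝ᵥ u, z.ofLp ⬝ᵥ w) :=
    Continuous.measurable (by fun_prop)
  have hpair := indepFun_prodMk_of_prodMk (memLp_two_dotProduct h.hasLaw_features u).aemeasurable
    (memLp_two_dotProduct h.hasLaw_features w).aemeasurable h.memLp_noise.aemeasurable
    (indepFun_dotProduct_dotProduct hS h.hasLaw_features huw) (h.indepFun.comp hproj measurable_id)
  exact hpair.comp measurable_id (measurable_fst.add measurable_snd)

section Score

variable (hS : S.PosSemidef) {u w : ι → ℝ} (huw : u ⬝ᵥ (S *ᵥ w) = 0)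

include hS huw

lemma memLp_dotProduct_mul_add_noise :
    MemLp (fun ω => ((x ω).ofLp ⬝ᵥ u) * ((x ω).ofLp ⬝ᵥ w + ξ ω)) 2 P := by
  have hu := memLp_two_dotProduct h.hasLaw_features u
  have hw := h.memLp_dotProduct_add_noise w
  refine (memLp_two_iff_integrable_sq (hu.1.mul hw.1)).2 ?_
  simp only [Pi.mul_apply, mul_pow]
  exact ((h.indepFun_dotProduct_add_noise hS huw).comp
    (φ := fun r : ℝ => r ^ 2) (ψ := fun r : ℝ => r ^ 2) (by fun_prop)
    (by fun_prop)).integrable_mul hu.integrable_sq hw.integrable_sq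

lemma integral_dotProduct_mul_add_noise :
    ∫ ω, ((x ω).ofLp ⬝ᵥ u) * ((x ω).ofLp ⬝ᵥ w + ξ ω) ∂P = 0 := by
  rw [(h.indepFun_dotProduct_add_noise hS huw).integral_fun_mul_eq_mul_integral
    (memLp_two_dotProduct h.hasLaw_features u).1 (h.memLp_dotProduct_add_noise w).1,
    integral_dotProduct_eq_zero h.hasLaw_features, zero_mul]

lemma integral_dotProduct_mul_add_noise_sq :
    ∫ ω, (((x ω).ofLp ⬝ᵥ u) * ((x ω).ofLp ⬝ᵥ w + ξ ω)) ^ 2 ∂P =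
      (u ⬝ᵥ (S *ᵥ u)) * (w ⬝ᵥ (S *ᵥ w) + (σ : ℝ) ^ 2) := by
  have hind := (h.indepFun_dotProduct_add_noise hS huw).comp
    (φ := fun r : ℝ => r ^ 2) (ψ := fun r : ℝ => r ^ 2) (by fun_prop) (by fun_prop)
  have hprod := hind.integral_fun_mul_eq_mul_integral
    (memLp_two_dotProduct h.hasLaw_features u).integrable_sq.1
    (h.memLp_dotProduct_add_noise w).integrable_sq.1
  simp only [mul_pow]
  refine hprod.trans ?_
  rw [← h.integral_dotProduct_add_noise_sq hS w,
    ← integral_dotProduct_mul_dotProduct hS h.hasLaw_features u u]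
  simp only [Function.comp_def, sq]

end Score

end IsRegressionSample

end RegressionSample

section LeastSquares

variable {n p : ℕ}

lemma ols_eq_wlsMatrix_mulVec (A : Matrix (Fin n) (Fin p) ℝ) (y : Fin n → ℝ) :
    ols A y = wlsMatrix A 1 *ᵥ y := by
  rw [ols, wlsMatrix, Matrix.mul_one, Matrix.mul_one, mulVec_mulVec]

lemma posSemidef_sampleCov (A : Matrix (Fin n) (Fin p) ℝ) : (sampleCov A).PosSemidef := by
  have hgram := posSemidef_conjTranspose_mul_self A
  rw [conjTranspose_eq_transpose_of_trivial] at hgram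
  exact hgram.smul (by positivity)

lemma isUnit_det_transpose_mul_self {A : Matrix (Fin n) (Fin p) ℝ}
    (hA : IsUnit (sampleCov A).det) : IsUnit (Aᵀ * A).det := by
  rw [sampleCov, det_smul] at hA
  exact isUnit_of_mul_isUnit_right hA

lemma inv_sampleCov {A : Matrix (Fin n) (Fin p) ℝ} (hn : n ≠ 0)
    (hA : IsUnit (sampleCov A).det) : (sampleCov A)⁻¹ = (n : ℝ) • (Aᵀ * A)⁻¹ := by
  refine inv_eq_left_inv ?_
  rw [sampleCov, smul_mul_smul_comm, mul_inv_cancel₀ (Nat.cast_ne_zero.2 hn),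
    nonsing_inv_mul _ (isUnit_det_transpose_mul_self hA), one_smul]

lemma ols_mulVec_add_sub {A : Matrix (Fin n) (Fin p) ℝ} (hn : n ≠ 0)
    (hA : IsUnit (sampleCov A).det) (t : Fin p → ℝ) (ε : Fin n → ℝ) :
    ols A (A *ᵥ t + ε) - t = (sampleCov A)⁻¹ *ᵥ ((n : ℝ)⁻¹ • (Aᵀ *ᵥ ε)) := by
  have hunit := isUnit_det_transpose_mul_self hA
  rw [ols_eq_wlsMatrix_mulVec, wlsMatrix_mulVec_sub (by rwa [Matrix.mul_one]),
    add_sub_cancel_left, ← ols_eq_wlsMatrix_mulVec, inv_sampleCov hn hA, smul_mulVec,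
    mulVec_smul, smul_inv_smul₀ (Nat.cast_ne_zero.2 hn), ols]

lemma trainError_eq_dotProduct (A : Matrix (Fin n) (Fin p) ℝ) (y : Fin n → ℝ) :
    trainError A y = (n : ℝ)⁻¹ * ((A *ᵥ ols A y - y) ⬝ᵥ (A *ᵥ ols A y - y)) := by
  simp only [trainError, dotProduct, Pi.sub_apply, sq]

lemma trainError_mulVec_add {A : Matrix (Fin n) (Fin p) ℝ} (hA : IsUnit (sampleCov A).det)
    (t : Fin p → ℝ) (ε : Fin n → ℝ) :
    trainError A (A *ᵥ t + ε) =
      (n : ℝ)⁻¹ * (ε ⬝ᵥ ε) - quad (sampleCov A) (ols A (A *ᵥ t + ε) - t) := by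
  have hunit : IsUnit (Aᵀ * (1 : Matrix (Fin n) (Fin n) ℝ) * A).det := by
    rw [Matrix.mul_one]
    exact isUnit_det_transpose_mul_self hA
  have hsplit := residual_dotProduct_mulVec_residual_eq_add isHermitian_one hunit
    (A *ᵥ t + ε) t
  rw [← ols_eq_wlsMatrix_mulVec, one_mulVec, one_mulVec, Matrix.mul_one,
    sub_add_cancel_left, neg_dotProduct_neg, ← neg_sub, mulVec_neg, neg_dotProduct_neg] at hsplit
  rw [trainError_eq_dotProduct, quad, sampleCov, smul_mulVec, dotProduct_smul, smul_eq_mul,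
    hsplit]
  ring

lemma measurable_sampleCov :
    Measurable fun A : Matrix (Fin n) (Fin p) ℝ => sampleCov A := by
  refine Continuous.measurable ?_
  unfold sampleCov
  fun_prop

lemma measurable_ols :
    Measurable fun z : Matrix (Fin n) (Fin p) ℝ × (Fin n → ℝ) => ols z.1 z.2 := by
  have hgram : Continuous fun z : Matrix (Fin n) (Fin p) ℝ × (Fin n → ℝ) => z.1ᵀ * z.1 := by
    fun_prop
  have hmoment : Continuous fun z : Matrix (Fin n) (Fin p) ℝ × (Fin n → ℝ) => z.1ᵀ *ᵥ z.2 := by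
    fun_prop
  have hmulVec : Continuous fun z : Matrix (Fin p) (Fin p) ℝ × (Fin p → ℝ) => z.1 *ᵥ z.2 := by
    fun_prop
  simpa only [ols, Function.comp_def] using hmulVec.measurable.comp
    ((measurable_matrix_inv.comp hgram.measurable).prodMk hmoment.measurable)

lemma measurable_trainError :
    Measurable fun z : Matrix (Fin n) (Fin p) ℝ × (Fin n → ℝ) => trainError z.1 z.2 := by
  have hloss : Continuous fun z : Matrix (Fin n) (Fin p) ℝ × (Fin n → ℝ) × (Fin p → ℝ) =>
      (n : ℝ)⁻¹ * ((z.1 *ᵥ z.2.2 - z.2.1) ⬝ᵥ (z.1 *ᵥ z.2.2 - z.2.1)) := by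
    fun_prop
  simpa only [trainError_eq_dotProduct, Function.comp_def] using
    hloss.measurable.comp (measurable_fst.prodMk (measurable_snd.prodMk measurable_ols))

end LeastSquares

section ZeroExtension

variable {p q d : ℕ}

/-- The extension by zero `Π₊ᵀ t` of a vector of observed coordinates: it turns linear forms in
the observed features into linear forms in the whole feature vector. -/
def extend (e : Fin p ⊕ Fin q ≃ Fin d) (t : Fin p → ℝ) : Fin d → ℝ :=
  fun k => Sum.elim t 0 (e.symm k)

lemma obs_extend (e : Fin p ⊕ Fin q ≃ Fin d) (t : Fin p → ℝ) : obs e (extend e t) = t := by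
  ext a
  simp [obs, extend]

lemma unobs_extend (e : Fin p ⊕ Fin q ≃ Fin d) (t : Fin p → ℝ) : unobs e (extend e t) = 0 := by
  ext a
  simp [unobs, extend]

lemma dotProduct_extend (e : Fin p ⊕ Fin q ≃ Fin d) (v : Fin d → ℝ) (t : Fin p → ℝ) :
    v ⬝ᵥ extend e t = obs e v ⬝ᵥ t := by
  rw [dotProduct_eq_obs_add_unobs e, obs_extend, unobs_extend, dotProduct_zero, add_zero]

lemma extend_dotProduct_mulVec_extend (e : Fin p ⊕ Fin q ≃ Fin d) (S : Matrix (Fin d) (Fin d) ℝ)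
    (s t : Fin p → ℝ) : extend e s ⬝ᵥ (S *ᵥ extend e t) = s ⬝ᵥ (blockPP e S *ᵥ t) := by
  rw [dotProduct_comm, dotProduct_extend, obs_mulVec, obs_extend, unobs_extend, mulVec_zero,
    add_zero, dotProduct_comm]

lemma extend_dotProduct_mulVec_residualDirection (e : Fin p ⊕ Fin q ≃ Fin d)
    {S : Matrix (Fin d) (Fin d) ℝ} (hS : IsUnit (blockPP e S).det) (θ : Fin d → ℝ)
    (t : Fin p → ℝ) : extend e t ⬝ᵥ (S *ᵥ residualDirection e S θ) = 0 := by
  rw [dotProduct_comm, dotProduct_extend, obs_mulVec_residualDirection e hS, zero_dotProduct]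

end ZeroExtension

section OneAgentAsymptotics

variable {Ω : Type*} {p q d : ℕ}

/-- The residual `y - ⟨x₊, T θ⟩` of the regression of the label of the sample `(x, ξ)` on the
observed features. -/
def residual (e : Fin p ⊕ Fin q ≃ Fin d) (S : Matrix (Fin d) (Fin d) ℝ) (θ : Fin d → ℝ)
    (z : EuclideanSpace ℝ (Fin d) × ℝ) : ℝ :=
  z.1.ofLp ⬝ᵥ residualDirection e S θ + z.2

/-- The score `(y - ⟨x₊, T θ⟩) x₊` of the sample `(x, ξ)`: the estimation error of least squares
is the sample average of the scores, up to the inverse sample covariance. -/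
def score (e : Fin p ⊕ Fin q ≃ Fin d) (S : Matrix (Fin d) (Fin d) ℝ) (θ : Fin d → ℝ)
    (z : EuclideanSpace ℝ (Fin d) × ℝ) : Fin p → ℝ :=
  residual e S θ z • obs e z.1.ofLp

/-- The covariance matrix of the score. -/
def scoreCov (e : Fin p ⊕ Fin q ≃ Fin d) (S : Matrix (Fin d) (Fin d) ℝ) (θ : Fin d → ℝ)
    (σ : ℝ≥0) : Matrix (Fin p) (Fin p) ℝ :=
  residualVariance e S θ σ • blockPP e S

/-- The sample second-moment matrix of the observed features. -/
abbrev localCov (e : Fin p ⊕ Fin q ≃ Fin d) (x : ℕ → Ω → EuclideanSpace ℝ (Fin d)) (n : ℕ)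
    (ω : Ω) : Matrix (Fin p) (Fin p) ℝ :=
  sampleCov (obsData e (dataMatrix x n ω))

lemma continuous_residual (e : Fin p ⊕ Fin q ≃ Fin d) (S : Matrix (Fin d) (Fin d) ℝ)
    (θ : Fin d → ℝ) : Continuous (residual e S θ) := by
  unfold residual
  fun_prop

lemma continuous_score (e : Fin p ⊕ Fin q ≃ Fin d) (S : Matrix (Fin d) (Fin d) ℝ)
    (θ : Fin d → ℝ) : Continuous (score e S θ) :=
  (continuous_residual e S θ).smul (by unfold obs; fun_prop)

lemma dotProduct_score (e : Fin p ⊕ Fin q ≃ Fin d) (S : Matrix (Fin d) (Fin d) ℝ)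
    (θ : Fin d → ℝ) (z : EuclideanSpace ℝ (Fin d) × ℝ) (t : Fin p → ℝ) :
    t ⬝ᵥ score e S θ z =
      (z.1.ofLp ⬝ᵥ extend e t) * (z.1.ofLp ⬝ᵥ residualDirection e S θ + z.2) := by
  rw [score, residual, dotProduct_smul, dotProduct_extend, smul_eq_mul, mul_comm, dotProduct_comm]

lemma posDef_scoreCov (e : Fin p ⊕ Fin q ≃ Fin d) {S : Matrix (Fin d) (Fin d) ℝ}
    (hS : S.PosDef) {θ : Fin d → ℝ} {σ : ℝ≥0} (hpos : 0 < residualVariance e S θ σ) :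
    (scoreCov e S θ σ).PosDef :=
  (posDef_blockPP e hS).smul hpos

lemma inv_blockPP_mul_scoreCov_mul_transpose (e : Fin p ⊕ Fin q ≃ Fin d)
    {S : Matrix (Fin d) (Fin d) ℝ} (hS : S.PosDef) {θ : Fin d → ℝ} {σ : ℝ≥0}
    (hpos : residualVariance e S θ σ ≠ 0) :
    (blockPP e S)⁻¹ * scoreCov e S θ σ * (blockPP e S)⁻¹ᵀ = (gaussianWeight e S θ σ)⁻¹ := by
  have hunit := (posDef_blockPP e hS).det_pos.ne'.isUnit
  have hsymm : (blockPP e S)⁻¹ᵀ = (blockPP e S)⁻¹ := by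
    simpa using (posDef_blockPP e hS).inv.isHermitian.eq
  rw [inv_gaussianWeight e hunit hpos, hsymm, scoreCov, Matrix.mul_smul, Matrix.smul_mul,
    nonsing_inv_mul _ hunit, Matrix.one_mul]

namespace IsRegressionSample

variable [MeasurableSpace Ω] {P : Measure Ω} {S : Matrix (Fin d) (Fin d) ℝ} {σ : ℝ≥0}
  {x : Ω → EuclideanSpace ℝ (Fin d)} {ξ : Ω → ℝ} {e : Fin p ⊕ Fin q ≃ Fin d}

lemma memLp_dotProduct_score (h : IsRegressionSample P S σ x ξ) (hS : S.PosSemidef)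
    (hunit : IsUnit (blockPP e S).det) (θ : Fin d → ℝ) (t : Fin p → ℝ) :
    MemLp (fun ω => t ⬝ᵥ score e S θ (x ω, ξ ω)) 2 P := by
  simpa only [dotProduct_score] using h.memLp_dotProduct_mul_add_noise hS
    (extend_dotProduct_mulVec_residualDirection e hunit θ t)

lemma integral_dotProduct_score (h : IsRegressionSample P S σ x ξ) (hS : S.PosSemidef)
    (hunit : IsUnit (blockPP e S).det) (θ : Fin d → ℝ) (t : Fin p → ℝ) :
    ∫ ω, t ⬝ᵥ score e S θ (x ω, ξ ω) ∂P = 0 := by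
  simpa only [dotProduct_score] using h.integral_dotProduct_mul_add_noise hS
    (extend_dotProduct_mulVec_residualDirection e hunit θ t)

lemma integral_dotProduct_score_sq (h : IsRegressionSample P S σ x ξ) (hS : S.PosSemidef)
    (hunit : IsUnit (blockPP e S).det) (θ : Fin d → ℝ) (t : Fin p → ℝ) :
    ∫ ω, (t ⬝ᵥ score e S θ (x ω, ξ ω)) ^ 2 ∂P = t ⬝ᵥ (scoreCov e S θ σ *ᵥ t) := by
  have hresidual := quad_residualDirection e hunit θ
  rw [quad] at hresidual
  simp only [dotProduct_score]
  rw [h.integral_dotProduct_mul_add_noise_sq hS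
    (extend_dotProduct_mulVec_residualDirection e hunit θ t), extend_dotProduct_mulVec_extend,
    hresidual, ← residualVariance, scoreCov, smul_mulVec, dotProduct_smul, smul_eq_mul, mul_comm]

end IsRegressionSample

section Averages

variable (e : Fin p ⊕ Fin q ≃ Fin d) (S : Matrix (Fin d) (Fin d) ℝ) (θ : Fin d → ℝ)
  (x : ℕ → Ω → EuclideanSpace ℝ (Fin d)) (ξ : ℕ → Ω → ℝ)

lemma labels_eq_transfer_add_residual (n : ℕ) (ω : Ω) :
    labels θ x ξ n ω = obsData e (dataMatrix x n ω) *ᵥ (transfer e S *ᵥ θ) +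
      fun j : Fin n => residual e S θ (x j ω, ξ j ω) := by
  ext j
  change (x j ω).ofLp ⬝ᵥ θ + ξ j ω = obs e (x j ω).ofLp ⬝ᵥ (transfer e S *ᵥ θ) +
    ((x j ω).ofLp ⬝ᵥ residualDirection e S θ + ξ j ω)
  rw [dotProduct_eq_transfer_add_residual e S θ (x j ω).ofLp, add_assoc]

lemma transpose_obsData_mulVec_residual (n : ℕ) (ω : Ω) :
    ((obsData e (dataMatrix x n ω))ᵀ *ᵥ fun j : Fin n => residual e S θ (x j ω, ξ j ω)) =
      ∑ j ∈ Finset.range n, score e S θ (x j ω, ξ j ω) := by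
  ext a
  rw [Finset.sum_apply, Finset.sum_range, mulVec, dotProduct]
  exact Finset.sum_congr rfl fun j _ => mul_comm _ _

lemma localOLS_sub_eq_average {n : ℕ} {ω : Ω} (hn : n ≠ 0)
    (hdet : IsUnit (localCov e x n ω).det) :
    localOLS e θ x ξ n ω - transfer e S *ᵥ θ = (localCov e x n ω)⁻¹ *ᵥ
      ((n : ℝ)⁻¹ • ∑ j ∈ Finset.range n, score e S θ (x j ω, ξ j ω)) := by
  rw [localOLS, labels_eq_transfer_add_residual e S, ols_mulVec_add_sub hn hdet,
    transpose_obsData_mulVec_residual]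

lemma localError_eq_average_sub {n : ℕ} {ω : Ω} (hdet : IsUnit (localCov e x n ω).det) :
    localError e θ x ξ n ω =
      (n : ℝ)⁻¹ * ∑ j ∈ Finset.range n, residual e S θ (x j ω, ξ j ω) ^ 2 -
        quad (localCov e x n ω) (localOLS e θ x ξ n ω - transfer e S *ᵥ θ) := by
  rw [localError, localOLS, labels_eq_transfer_add_residual e S, trainError_mulVec_add hdet,
    Finset.sum_range]
  simp only [dotProduct, sq]

lemma localCov_apply_eq_average (n : ℕ) (ω : Ω) (a b : Fin p) :
    localCov e x n ω a b = (n : ℝ)⁻¹ * ∑ j ∈ Finset.range n,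
      ((x j ω).ofLp ⬝ᵥ extend e (Pi.single a 1)) * ((x j ω).ofLp ⬝ᵥ extend e (Pi.single b 1)) := by
  simp only [dotProduct_extend, dotProduct_single_one]
  rw [Finset.sum_range]
  rfl

end Averages

section Measurability

variable [MeasurableSpace Ω] {P : Measure Ω} (e : Fin p ⊕ Fin q ≃ Fin d) (θ : Fin d → ℝ)
  {x : ℕ → Ω → EuclideanSpace ℝ (Fin d)} {ξ : ℕ → Ω → ℝ}
  (hx : ∀ j, AEMeasurable (x j) P) (hξ : ∀ j, AEMeasurable (ξ j) P) (n : ℕ)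

include hx

lemma aemeasurable_obsData : AEMeasurable (fun ω => obsData e (dataMatrix x n ω)) P :=
  aemeasurable_pi_lambda _ fun j => aemeasurable_pi_lambda _ fun a =>
    Measurable.comp_aemeasurable
      (g := fun v : EuclideanSpace ℝ (Fin d) => v (e (Sum.inl a))) (by fun_prop) (hx j)

lemma aemeasurable_localCov : AEMeasurable (localCov e x n) P :=
  measurable_sampleCov.comp_aemeasurable (aemeasurable_obsData e hx n)

include hξ

lemma aemeasurable_labels : AEMeasurable (labels θ x ξ n) P :=
  aemeasurable_pi_lambda _ fun j =>
    (Measurable.comp_aemeasurable (g := fun v : EuclideanSpace ℝ (Fin d) => v.ofLp ⬝ᵥ θ)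
      (Continuous.measurable (by fun_prop)) (hx j)).add (hξ j)

lemma aemeasurable_localOLS : AEMeasurable (localOLS e θ x ξ n) P := by
  have h := measurable_ols.comp_aemeasurable
    ((aemeasurable_obsData e hx n).prodMk (aemeasurable_labels θ hx hξ n))
  unfold localOLS
  exact h

lemma aemeasurable_localError : AEMeasurable (localError e θ x ξ n) P := by
  have h := measurable_trainError.comp_aemeasurable
    ((aemeasurable_obsData e hx n).prodMk (aemeasurable_labels θ hx hξ n))
  unfold localError
  exact h

end Measurability

lemma eventually_isUnit_det {ι : Type*} [Fintype ι] [DecidableEq ι]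
    {A : ℕ → Matrix ι ι ℝ} {B : Matrix ι ι ℝ} (hA : Tendsto A atTop (𝓝 B))
    (hB : IsUnit B.det) : ∀ᶠ n in atTop, IsUnit (A n).det := by
  have hdet := ((Continuous.matrix_det continuous_id).tendsto B).comp hA
  filter_upwards [hdet.eventually_ne hB.ne_zero] with n hn using hn.isUnit

variable [MeasurableSpace Ω] {P : Measure Ω}

/-- The data of one agent: pairwise independent, identically distributed regression samples. -/
structure IsRegressionSequence (P : Measure Ω) (S : Matrix (Fin d) (Fin d) ℝ) (σ : ℝ≥0)
    (x : ℕ → Ω → EuclideanSpace ℝ (Fin d)) (ξ : ℕ → Ω → ℝ) : Prop where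
  isRegressionSample : ∀ j, IsRegressionSample P S σ (x j) (ξ j)
  identDistrib_noise : ∀ j, IdentDistrib (ξ j) (ξ 0) P P
  pairwise_indepFun : Pairwise fun j k => IndepFun (fun ω => (x j ω, ξ j ω))
    (fun ω => (x k ω, ξ k ω)) P

namespace IsRegressionSequence

variable {S : Matrix (Fin d) (Fin d) ℝ} {θ : Fin d → ℝ} {σ : ℝ≥0}
  {x : ℕ → Ω → EuclideanSpace ℝ (Fin d)} {ξ : ℕ → Ω → ℝ}

lemma aemeasurable_features (h : IsRegressionSequence P S σ x ξ) (j : ℕ) :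
    AEMeasurable (x j) P :=
  (h.isRegressionSample j).hasLaw_features.aemeasurable

lemma aemeasurable_noise (h : IsRegressionSequence P S σ x ξ) (j : ℕ) :
    AEMeasurable (ξ j) P :=
  (h.isRegressionSample j).memLp_noise.aemeasurable

variable [IsProbabilityMeasure P]

lemma identDistrib (h : IsRegressionSequence P S σ x ξ) (j : ℕ) :
    IdentDistrib (fun ω => (x j ω, ξ j ω)) (fun ω => (x 0 ω, ξ 0 ω)) P P :=
  IdentDistrib.prodMk
    ⟨h.aemeasurable_features j, h.aemeasurable_features 0,
      (h.isRegressionSample j).hasLaw_features.map_eq.trans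
        (h.isRegressionSample 0).hasLaw_features.map_eq.symm⟩
    (h.identDistrib_noise j) (h.isRegressionSample j).indepFun (h.isRegressionSample 0).indepFun

lemma tendsto_localCov_ae (h : IsRegressionSequence P S σ x ξ) (hS : S.PosSemidef)
    (e : Fin p ⊕ Fin q ≃ Fin d) :
    ∀ᵐ ω ∂P, Tendsto (fun n => localCov e x n ω) atTop (𝓝 (blockPP e S)) := by
  have hx := (h.isRegressionSample 0).hasLaw_features
  have hentry (a b : Fin p) : ∀ᵐ ω ∂P, Tendsto (fun n => localCov e x n ω a b) atTop
      (𝓝 (blockPP e S a b)) := by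
    have hlln := tendsto_average_ae h.pairwise_indepFun h.identDistrib
      (f := fun z => (z.1.ofLp ⬝ᵥ extend e (Pi.single a 1)) *
        (z.1.ofLp ⬝ᵥ extend e (Pi.single b 1)))
      (Continuous.measurable (by fun_prop))
      ((memLp_two_dotProduct hx _).integrable_mul (memLp_two_dotProduct hx _))
    rw [integral_dotProduct_mul_dotProduct hS hx, extend_dotProduct_mulVec_extend,
      mulVec_single_one, single_one_dotProduct, col_apply] at hlln
    simpa only [localCov_apply_eq_average] using hlln
  filter_upwards [ae_all_iff.2 fun a => ae_all_iff.2 (hentry a)] with ω hω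
  exact tendsto_pi_nhds.2 fun a => tendsto_pi_nhds.2 (hω a)

lemma tendsto_average_score_ae (h : IsRegressionSequence P S σ x ξ) (hS : S.PosSemidef)
    {e : Fin p ⊕ Fin q ≃ Fin d} (hunit : IsUnit (blockPP e S).det) :
    ∀ᵐ ω ∂P, Tendsto
      (fun n : ℕ => (n : ℝ)⁻¹ • ∑ j ∈ Finset.range n, score e S θ (x j ω, ξ j ω)) atTop
      (𝓝 0) := by
  have hentry (a : Fin p) : ∀ᵐ ω ∂P, Tendsto (fun n : ℕ => (n : ℝ)⁻¹ *
      ∑ j ∈ Finset.range n, score e S θ (x j ω, ξ j ω) a) atTop (𝓝 0) := by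
    have hlln := tendsto_average_ae h.pairwise_indepFun h.identDistrib
      (Continuous.measurable (f := fun z => Pi.single a 1 ⬝ᵥ score e S θ z)
        (continuous_const.dotProduct (continuous_score e S θ)))
      (((h.isRegressionSample 0).memLp_dotProduct_score hS hunit θ _).integrable one_le_two)
    rw [(h.isRegressionSample 0).integral_dotProduct_score hS hunit] at hlln
    simpa only [single_one_dotProduct] using hlln
  filter_upwards [ae_all_iff.2 hentry] with ω hω
  refine tendsto_pi_nhds.2 fun a => ?_
  simpa only [Pi.smul_apply, Finset.sum_apply, smul_eq_mul, Pi.zero_apply] using hω a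

lemma tendsto_average_residual_sq_ae (h : IsRegressionSequence P S σ x ξ) (hS : S.PosSemidef)
    {e : Fin p ⊕ Fin q ≃ Fin d} (hunit : IsUnit (blockPP e S).det) :
    ∀ᵐ ω ∂P, Tendsto
      (fun n : ℕ => (n : ℝ)⁻¹ * ∑ j ∈ Finset.range n, residual e S θ (x j ω, ξ j ω) ^ 2) atTop
      (𝓝 (residualVariance e S θ σ)) := by
  have hlln := tendsto_average_ae h.pairwise_indepFun h.identDistrib
    ((continuous_residual e S θ).pow 2).measurable
    ((h.isRegressionSample 0).memLp_dotProduct_add_noise (residualDirection e S θ)).integrable_sq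
  have hvar := (h.isRegressionSample 0).integral_dotProduct_add_noise_sq hS
    (residualDirection e S θ)
  rw [← quad, quad_residualDirection e hunit, ← residualVariance] at hvar
  rwa [← hvar]

lemma tendsto_localError_ae (h : IsRegressionSequence P S σ x ξ) (hS : S.PosSemidef)
    {e : Fin p ⊕ Fin q ≃ Fin d} (hunit : IsUnit (blockPP e S).det) :
    ∀ᵐ ω ∂P, Tendsto (fun n => localError e θ x ξ n ω) atTop
      (𝓝 (residualVariance e S θ σ)) := by
  filter_upwards [h.tendsto_localCov_ae hS e, h.tendsto_average_score_ae (θ := θ) hS hunit,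
    h.tendsto_average_residual_sq_ae (θ := θ) hS hunit] with ω hcov hscore hresidual
  have hols : Tendsto (fun n => (localCov e x n ω)⁻¹ *ᵥ
      ((n : ℝ)⁻¹ • ∑ j ∈ Finset.range n, score e S θ (x j ω, ξ j ω))) atTop (𝓝 0) := by
    have hmulVec : Continuous fun z : Matrix (Fin p) (Fin p) ℝ × (Fin p → ℝ) => z.1 *ᵥ z.2 := by
      fun_prop
    have hinv := (continuousAt_matrix_inv_of_isUnit_det hunit).tendsto.comp hcov
    simpa only [mulVec_zero, Function.comp_def] using
      (hmulVec.tendsto ((blockPP e S)⁻¹, 0)).comp (hinv.prodMk_nhds hscore)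
  have hquad : Continuous fun z : Matrix (Fin p) (Fin p) ℝ × (Fin p → ℝ) => quad z.1 z.2 := by
    unfold quad
    fun_prop
  have hlim := hresidual.sub ((hquad.tendsto (blockPP e S, 0)).comp (hcov.prodMk_nhds hols))
  simp only [quad, mulVec_zero, dotProduct_zero, sub_zero] at hlim
  refine hlim.congr' ?_
  filter_upwards [eventually_isUnit_det hcov hunit, eventually_ne_atTop 0] with n hdet hn
  rw [localError_eq_average_sub e S θ x ξ hdet, localOLS_sub_eq_average e S θ x ξ hn hdet]
  rfl

end IsRegressionSequence

end OneAgentAsymptotics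

section Consistency

variable {Ω : Type*} [MeasurableSpace Ω] {P : Measure Ω} {κ : Type*}

/-- Strong consistency of the estimators `Ahat n` of a positive definite matrix `A`, with almost
surely only finitely many estimates that fail to be positive definite. -/
structure IsPosDefConsistent (P : Measure Ω) (Ahat : ℕ → Ω → Matrix κ κ ℝ) (A : Matrix κ κ ℝ) :
    Prop where
  posDef : A.PosDef
  aemeasurable : ∀ n, AEMeasurable (Ahat n) P
  tendsto_ae : ∀ᵐ ω ∂P, Tendsto (fun n => Ahat n ω) atTop (𝓝 A)
  eventually_posDef : ∀ᵐ ω ∂P, ∀ᶠ n in atTop, (Ahat n ω).PosDef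

variable {Ahat : ℕ → Ω → Matrix κ κ ℝ} {A : Matrix κ κ ℝ}

lemma IsPosDefConsistent.const (hA : A.PosDef) : IsPosDefConsistent P (fun _ _ => A) A where
  posDef := hA
  aemeasurable _ := aemeasurable_const
  tendsto_ae := ae_of_all _ fun _ => tendsto_const_nhds
  eventually_posDef := ae_of_all _ fun _ => .of_forall fun _ => hA

lemma IsPosDefConsistent.of_posSemidef [Finite κ] (hA : A.PosDef)
    (hAhat : ∀ n ω, (Ahat n ω).PosSemidef) (hmeas : ∀ n, AEMeasurable (Ahat n) P)
    (hlim : ∀ᵐ ω ∂P, Tendsto (fun n => Ahat n ω) atTop (𝓝 A)) : IsPosDefConsistent P Ahat A where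
  posDef := hA
  aemeasurable := hmeas
  tendsto_ae := hlim
  eventually_posDef := by
    classical
    have := Fintype.ofFinite κ
    filter_upwards [hlim] with ω hω
    filter_upwards [eventually_isUnit_det hω hA.det_pos.ne'.isUnit] with n hdet
    exact (hAhat n ω).posDef_iff_isUnit.2 ((isUnit_iff_isUnit_det _).2 hdet)

lemma IsPosDefConsistent.inv_smul [Finite κ] (hA : IsPosDefConsistent P Ahat A)
    {R : ℕ → Ω → ℝ} {r : ℝ} (hr : 0 < r) (hR : ∀ n, AEMeasurable (R n) P)
    (hlim : ∀ᵐ ω ∂P, Tendsto (fun n => R n ω) atTop (𝓝 r)) :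
    IsPosDefConsistent P (fun n ω => (R n ω)⁻¹ • Ahat n ω) (r⁻¹ • A) where
  posDef := hA.posDef.smul (inv_pos.2 hr)
  aemeasurable n := (hR n).inv.smul (hA.aemeasurable n)
  tendsto_ae := by
    filter_upwards [hlim, hA.tendsto_ae] with ω hω hAω using (hω.inv₀ hr.ne').smul hAω
  eventually_posDef := by
    filter_upwards [hlim, hA.eventually_posDef] with ω hω hAω
    filter_upwards [hω.eventually_const_lt hr, hAω] with n hn hAn using hAn.smul (inv_pos.2 hn)

lemma IsPosDefConsistent.inv [Fintype κ] [DecidableEq κ] (hA : IsPosDefConsistent P Ahat A) :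
    IsPosDefConsistent P (fun n ω => (Ahat n ω)⁻¹) A⁻¹ where
  posDef := hA.posDef.inv
  aemeasurable n := measurable_matrix_inv.comp_aemeasurable (hA.aemeasurable n)
  tendsto_ae := by
    filter_upwards [hA.tendsto_ae] with ω hω
    exact (continuousAt_matrix_inv_of_isUnit_det hA.posDef.det_pos.ne'.isUnit).tendsto.comp hω
  eventually_posDef := by
    filter_upwards [hA.eventually_posDef] with ω hω using hω.mono fun _ hn => hn.inv

lemma IsPosDefConsistent.blockDiagonal' {I : Type*} [Finite I] [DecidableEq I] {κ : I → Type*}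
    [∀ i, Finite (κ i)] {Ahat : ℕ → Ω → ∀ i, Matrix (κ i) (κ i) ℝ}
    {A : ∀ i, Matrix (κ i) (κ i) ℝ}
    (hA : ∀ i, IsPosDefConsistent P (fun n ω => Ahat n ω i) (A i)) :
    IsPosDefConsistent P (fun n ω => Matrix.blockDiagonal' (Ahat n ω))
      (Matrix.blockDiagonal' A) where
  posDef := posDef_blockDiagonal' fun i => (hA i).posDef
  aemeasurable n := (continuous_id.matrix_blockDiagonal' (A := id)).measurable.comp_aemeasurable
    (aemeasurable_pi_lambda _ fun i => (hA i).aemeasurable n)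
  tendsto_ae := by
    filter_upwards [ae_all_iff.2 fun i => (hA i).tendsto_ae] with ω hω
    exact (continuous_id.matrix_blockDiagonal'.tendsto A).comp (tendsto_pi_nhds.2 hω)
  eventually_posDef := by
    filter_upwards [ae_all_iff.2 fun i => (hA i).eventually_posDef] with ω hω
    filter_upwards [eventually_all.2 hω] with n hn using posDef_blockDiagonal' hn

lemma tendsto_measure_forall_posDef [IsProbabilityMeasure P] {I : Type*} [Finite I]
    {κ : I → Type*} {What : ℕ → Ω → ∀ i, Matrix (κ i) (κ i) ℝ} {W : ∀ i, Matrix (κ i) (κ i) ℝ}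
    (hW : ∀ i, IsPosDefConsistent P (fun n ω => What n ω i) (W i)) :
    Tendsto (fun n => P {ω | ∀ i, (What n ω i).PosDef}) atTop (𝓝 1) := by
  refine tendsto_measure_one_of_ae_eventually ?_
  filter_upwards [ae_all_iff.2 fun i => (hW i).eventually_posDef] with ω hω
  exact eventually_all.2 hω

lemma IsRegressionSequence.isPosDefConsistent_localCov [IsProbabilityMeasure P] {d p q : ℕ}
    {S : Matrix (Fin d) (Fin d) ℝ} {σ : ℝ≥0} {x : ℕ → Ω → EuclideanSpace ℝ (Fin d)}
    {ξ : ℕ → Ω → ℝ} (h : IsRegressionSequence P S σ x ξ) (hS : S.PosDef)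
    (e : Fin p ⊕ Fin q ≃ Fin d) : IsPosDefConsistent P (localCov e x) (blockPP e S) :=
  .of_posSemidef (posDef_blockPP e hS) (fun _ _ => posSemidef_sampleCov _)
    (aemeasurable_localCov e h.aemeasurable_features) (h.tendsto_localCov_ae hS.posSemidef e)

lemma IsRegressionSequence.isPosDefConsistent_inv_localError_smul [IsProbabilityMeasure P]
    {d p q : ℕ} {S : Matrix (Fin d) (Fin d) ℝ} {θ : Fin d → ℝ} {σ : ℝ≥0}
    {x : ℕ → Ω → EuclideanSpace ℝ (Fin d)} {ξ : ℕ → Ω → ℝ} (h : IsRegressionSequence P S σ x ξ)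
    (hS : S.PosDef) (e : Fin p ⊕ Fin q ≃ Fin d) (hpos : 0 < residualVariance e S θ σ)
    {Shat : ℕ → Ω → Matrix (Fin p) (Fin p) ℝ}
    (hShat : IsPosDefConsistent P Shat (blockPP e S)) :
    IsPosDefConsistent P (fun n ω => (localError e θ x ξ n ω)⁻¹ • Shat n ω)
      (gaussianWeight e S θ σ) :=
  hShat.inv_smul hpos
    (aemeasurable_localError e θ h.aemeasurable_features h.aemeasurable_noise)
    (h.tendsto_localError_ae hS.posSemidef (posDef_blockPP e hS).det_pos.ne'.isUnit)

end Consistency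

section Federation

variable {Ω : Type*} {m d : ℕ} {p q : Fin m → ℕ}
  {S : Matrix (Fin d) (Fin d) ℝ} {σ : ℝ≥0}

/-- The scores of all agents, for one sample per agent. -/
def stackedScore (e : ∀ i, Fin (p i) ⊕ Fin (q i) ≃ Fin d) (S : Matrix (Fin d) (Fin d) ℝ)
    (θ : Fin d → ℝ) (z : Fin m → EuclideanSpace ℝ (Fin d) × ℝ) : (Σ i, Fin (p i)) → ℝ :=
  Sigma.uncurry fun i => score (e i) S θ (z i)

/-- The rescaled estimation errors of all local least squares estimates. -/
def stackedError (e : ∀ i, Fin (p i) ⊕ Fin (q i) ≃ Fin d) (S : Matrix (Fin d) (Fin d) ℝ)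
    (θ : Fin d → ℝ) (x : Fin m → ℕ → Ω → EuclideanSpace ℝ (Fin d)) (ξ : Fin m → ℕ → Ω → ℝ)
    (n : ℕ) (ω : Ω) : (Σ i, Fin (p i)) → ℝ :=
  √(n : ℝ) • Sigma.uncurry fun i => localOLS (e i) θ (x i) (ξ i) n ω - transfer (e i) S *ᵥ θ

variable {x : Fin m → ℕ → Ω → EuclideanSpace ℝ (Fin d)} {ξ : Fin m → ℕ → Ω → ℝ}
  {e : ∀ i, Fin (p i) ⊕ Fin (q i) ≃ Fin d} {θ : Fin d → ℝ}

lemma continuous_stackedScore (e : ∀ i, Fin (p i) ⊕ Fin (q i) ≃ Fin d)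
    (S : Matrix (Fin d) (Fin d) ℝ) (θ : Fin d → ℝ) : Continuous (stackedScore e S θ) :=
  continuous_pi fun s => (continuous_apply s.2).comp
    ((continuous_score (e s.1) S θ).comp (continuous_apply s.1))

lemma uncurry_dotProduct_stackedScore (u : ∀ i, Fin (p i) → ℝ)
    (z : Fin m → EuclideanSpace ℝ (Fin d) × ℝ) :
    Sigma.uncurry u ⬝ᵥ stackedScore e S θ z = ∑ i, u i ⬝ᵥ score (e i) S θ (z i) :=
  uncurry_dotProduct_uncurry _ _

lemma posSemidef_stackedCov (hS : S.PosDef) (hpos : ∀ i, 0 < residualVariance (e i) S θ σ) :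
    (stackedCov e S θ σ).PosSemidef :=
  (posDef_blockDiagonal' fun i => (posDef_gaussianWeight (e i) hS (hpos i)).inv).posSemidef

lemma stackedCov_eq_blockDiagonal'_mul (hS : S.PosDef)
    (hpos : ∀ i, residualVariance (e i) S θ σ ≠ 0) :
    stackedCov e S θ σ = blockDiagonal' (fun i => (blockPP (e i) S)⁻¹) *
      blockDiagonal' (fun i => scoreCov (e i) S θ σ) *
      (blockDiagonal' fun i => (blockPP (e i) S)⁻¹)ᵀ := by
  rw [blockDiagonal'_transpose, ← blockDiagonal'_mul, ← blockDiagonal'_mul, stackedCov]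
  congr 1
  funext i
  exact (inv_blockPP_mul_scoreCov_mul_transpose (e i) hS (hpos i)).symm

lemma stackedError_eq_blockDiagonal'_mulVec {n : ℕ} {ω : Ω} (hn : n ≠ 0)
    (hdet : ∀ i, IsUnit (localCov (e i) (x i) n ω).det) :
    stackedError e S θ x ξ n ω = blockDiagonal' (fun i => (localCov (e i) (x i) n ω)⁻¹) *ᵥ
      ((√(n : ℝ))⁻¹ • ∑ j ∈ Finset.range n, stackedScore e S θ fun i => (x i j ω, ξ i j ω)) := by
  have hsqrt : √(n : ℝ) * (n : ℝ)⁻¹ = (√(n : ℝ))⁻¹ := by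
    rw [← div_eq_mul_inv, Real.sqrt_div_self]
  have hsum : ∑ j ∈ Finset.range n, stackedScore e S θ (fun i => (x i j ω, ξ i j ω)) =
      Sigma.uncurry fun i => ∑ j ∈ Finset.range n, score (e i) S θ (x i j ω, ξ i j ω) := by
    ext ⟨i, a⟩
    simp only [stackedScore, Sigma.uncurry, Finset.sum_apply]
  rw [hsum, mulVec_smul, blockDiagonal'_mulVec, stackedError, ← hsqrt, mul_smul]
  congr 1
  ext ⟨i, a⟩
  simp only [Sigma.uncurry, Pi.smul_apply]
  rw [localOLS_sub_eq_average (e i) S θ (x i) (ξ i) hn (hdet i), mulVec_smul, Pi.smul_apply]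

variable [MeasurableSpace Ω] {P : Measure Ω}

/-- The data of all agents: regression samples which are independent within and across agents,
the noise of every agent being identically distributed. -/
structure IsFederatedSample (P : Measure Ω) (S : Matrix (Fin d) (Fin d) ℝ) (σ : ℝ≥0)
    (x : Fin m → ℕ → Ω → EuclideanSpace ℝ (Fin d)) (ξ : Fin m → ℕ → Ω → ℝ) : Prop where
  isRegressionSample : ∀ i j, IsRegressionSample P S σ (x i j) (ξ i j)
  identDistrib_noise : ∀ i j, IdentDistrib (ξ i j) (ξ i 0) P P
  iIndepFun_samples : iIndepFun
    (fun (s : Fin m × ℕ) (ω : Ω) => (x s.1 s.2 ω, ξ s.1 s.2 ω)) P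

lemma tendstoGaussian_block {κ : Fin m → Type*} [∀ i, Fintype (κ i)] [∀ i, DecidableEq (κ i)]
    [IsProbabilityMeasure P] {Z : ℕ → Ω → (Σ i, κ i) → ℝ} {C : ∀ i, Matrix (κ i) (κ i) ℝ}
    (hC : (blockDiagonal' C).PosSemidef) (hZ : TendstoGaussian P Z (blockDiagonal' C))
    (i : Fin m) : TendstoGaussian P (fun n ω a => Z n ω ⟨i, a⟩) (C i) := by
  have h := hZ.mulVec hC ((1 : Matrix (Σ i, κ i) (Σ i, κ i) ℝ).submatrix (Sigma.mk i) id)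
  convert! h using 1
  · funext n ω a
    simp [mulVec, dotProduct, Matrix.one_apply]
  · ext a b
    simp [Matrix.mul_apply, Matrix.one_apply]

namespace IsFederatedSample

lemma agent (h : IsFederatedSample P S σ x ξ) (i : Fin m) :
    IsRegressionSequence P S σ (x i) (ξ i) where
  isRegressionSample := h.isRegressionSample i
  identDistrib_noise := h.identDistrib_noise i
  pairwise_indepFun _ _ hjk :=
    h.iIndepFun_samples.indepFun (i := (i, _)) (j := (i, _)) (by simpa using hjk)

lemma iIndepFun_agents (h : IsFederatedSample P S σ x ξ) (j : ℕ) :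
    iIndepFun (fun i ω => (x i j ω, ξ i j ω)) P :=
  h.iIndepFun_samples.precomp (g := fun i => (i, j)) fun _ _ heq => (Prod.mk.inj heq).1

lemma of_hasLaw_gaussianReal (hx : ∀ i j, HasLaw (x i j) (multivariateGaussian 0 S) P)
    (hξ : ∀ i j, HasLaw (ξ i j) (gaussianReal 0 (σ ^ 2)) P)
    (hxξ : ∀ i j, IndepFun (x i j) (ξ i j) P)
    (hindep : iIndepFun (fun (s : Fin m × ℕ) (ω : Ω) => (x s.1 s.2 ω, ξ s.1 s.2 ω)) P) :
    IsFederatedSample P S σ x ξ where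
  isRegressionSample i j := isRegressionSample_of_hasLaw_gaussianReal (hx i j) (hξ i j) (hxξ i j)
  identDistrib_noise i j := (hξ i j).identDistrib (hξ i 0)
  iIndepFun_samples := hindep

section StackedScore

variable (h : IsFederatedSample P S σ x ξ) (hS : S.PosDef)

include h hS

lemma memLp_dotProduct_stackedScore (t : (Σ i, Fin (p i)) → ℝ) :
    MemLp (fun ω => t ⬝ᵥ stackedScore e S θ fun i => (x i 0 ω, ξ i 0 ω)) 2 P := by
  obtain ⟨u, rfl⟩ : ∃ u : ∀ i, Fin (p i) → ℝ, t = Sigma.uncurry u := ⟨Sigma.curry t, rfl⟩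
  simp only [uncurry_dotProduct_stackedScore]
  exact memLp_finsetSum _ fun i _ => (h.isRegressionSample i 0).memLp_dotProduct_score
    hS.posSemidef (posDef_blockPP (e i) hS).det_pos.ne'.isUnit θ (u i)

variable [IsProbabilityMeasure P]

lemma integral_dotProduct_stackedScore (t : (Σ i, Fin (p i)) → ℝ) :
    ∫ ω, t ⬝ᵥ stackedScore e S θ (fun i => (x i 0 ω, ξ i 0 ω)) ∂P = 0 := by
  obtain ⟨u, rfl⟩ : ∃ u : ∀ i, Fin (p i) → ℝ, t = Sigma.uncurry u := ⟨Sigma.curry t, rfl⟩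
  have hunit (i) := (posDef_blockPP (e i) hS).det_pos.ne'.isUnit
  simp only [uncurry_dotProduct_stackedScore]
  rw [integral_finsetSum _ fun i _ => ((h.isRegressionSample i 0).memLp_dotProduct_score
    hS.posSemidef (hunit i) θ (u i)).integrable one_le_two]
  exact Finset.sum_eq_zero fun i _ =>
    (h.isRegressionSample i 0).integral_dotProduct_score hS.posSemidef (hunit i) θ (u i)

lemma integral_dotProduct_stackedScore_sq (t : (Σ i, Fin (p i)) → ℝ) :
    ∫ ω, (t ⬝ᵥ stackedScore e S θ fun i => (x i 0 ω, ξ i 0 ω)) ^ 2 ∂P =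
      t ⬝ᵥ (blockDiagonal' (fun i => scoreCov (e i) S θ σ) *ᵥ t) := by
  obtain ⟨u, rfl⟩ : ∃ u : ∀ i, Fin (p i) → ℝ, t = Sigma.uncurry u := ⟨Sigma.curry t, rfl⟩
  have hunit (i) := (posDef_blockPP (e i) hS).det_pos.ne'.isUnit
  have hindep : iIndepFun (fun i ω => u i ⬝ᵥ score (e i) S θ (x i 0 ω, ξ i 0 ω)) P :=
    (h.iIndepFun_agents 0).comp (fun i z => u i ⬝ᵥ score (e i) S θ z) fun i =>
      (continuous_const.dotProduct (continuous_score (e i) S θ)).measurable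
  simp only [uncurry_dotProduct_stackedScore, uncurry_dotProduct_blockDiagonal'_mulVec]
  rw [integral_sum_sq_of_indepFun
    (fun i => (h.isRegressionSample i 0).memLp_dotProduct_score hS.posSemidef (hunit i) θ (u i))
    (fun i => (h.isRegressionSample i 0).integral_dotProduct_score hS.posSemidef (hunit i) θ (u i))
    fun i j hij => hindep.indepFun hij]
  exact Finset.sum_congr rfl fun i _ =>
    (h.isRegressionSample i 0).integral_dotProduct_score_sq hS.posSemidef (hunit i) θ (u i)

end StackedScore

lemma aemeasurable_stackedError (h : IsFederatedSample P S σ x ξ) (n : ℕ) :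
    AEMeasurable (stackedError e S θ x ξ n) P := by
  refine aemeasurable_pi_lambda _ fun s => ?_
  have hols := aemeasurable_localOLS (e s.1) θ
    (h.agent s.1).aemeasurable_features (h.agent s.1).aemeasurable_noise n
  simp only [stackedError, Pi.smul_apply, Sigma.uncurry, smul_eq_mul, Pi.sub_apply]
  exact ((aemeasurable_pi_iff.1 hols s.2).sub_const _).const_mul _

variable [IsProbabilityMeasure P]

lemma iIndepFun_rounds (h : IsFederatedSample P S σ x ξ) :
    iIndepFun (fun j ω i => (x i j ω, ξ i j ω)) P :=
  iIndepFun_curry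
    (fun j i => ((h.agent i).aemeasurable_features j).prodMk ((h.agent i).aemeasurable_noise j))
    (h.iIndepFun_samples.precomp (g := Prod.swap) Prod.swap_injective)

lemma identDistrib_rounds (h : IsFederatedSample P S σ x ξ) (j : ℕ) :
    IdentDistrib (fun ω i => (x i j ω, ξ i j ω)) (fun ω i => (x i 0 ω, ξ i 0 ω)) P P :=
  IdentDistrib.pi (fun i => (h.agent i).identDistrib j) (h.iIndepFun_agents j)
    (h.iIndepFun_agents 0)

lemma tendstoGaussian_stackedScore (h : IsFederatedSample P S σ x ξ) (hS : S.PosDef)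
    (hpos : ∀ i, 0 < residualVariance (e i) S θ σ) :
    TendstoGaussian P (fun n ω => (√(n : ℝ))⁻¹ •
        ∑ j ∈ Finset.range n, stackedScore e S θ fun i => (x i j ω, ξ i j ω))
      (blockDiagonal' fun i => scoreCov (e i) S θ σ) :=
  have hmeas := (continuous_stackedScore e S θ).measurable
  tendstoGaussian_inv_sqrt_smul_sum
    (posDef_blockDiagonal' fun i => posDef_scoreCov (e i) hS (hpos i)).posSemidef
    (h.iIndepFun_rounds.comp (fun _ => stackedScore e S θ) fun _ => hmeas)
    (fun j => (h.identDistrib_rounds j).comp hmeas) (h.memLp_dotProduct_stackedScore hS)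
    (h.integral_dotProduct_stackedScore hS) (h.integral_dotProduct_stackedScore_sq hS)

lemma tendstoGaussian_stackedError (h : IsFederatedSample P S σ x ξ) (hS : S.PosDef)
    (hpos : ∀ i, 0 < residualVariance (e i) S θ σ) :
    TendstoGaussian P (stackedError e S θ x ξ) (stackedCov e S θ σ) := by
  have hcov (i) := (h.agent i).isPosDefConsistent_localCov hS (e i)
  have hinv := IsPosDefConsistent.blockDiagonal' fun i => (hcov i).inv
  rw [stackedCov_eq_blockDiagonal'_mul hS fun i => (hpos i).ne']
  refine ((h.tendstoGaussian_stackedScore hS hpos).mulVec_of_tendsto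
    (posDef_blockDiagonal' fun i => posDef_scoreCov (e i) hS (hpos i)).posSemidef
    hinv.aemeasurable hinv.tendsto_ae).congr_ae_eventually h.aemeasurable_stackedError ?_
  filter_upwards [ae_all_iff.2 fun i => (hcov i).eventually_posDef] with ω hω
  filter_upwards [eventually_all.2 hω, eventually_ne_atTop 0] with n hposDef hn
  exact stackedError_eq_blockDiagonal'_mulVec hn fun i => (hposDef i).det_pos.ne'.isUnit

theorem tendstoNormal_localOLS (h : IsFederatedSample P S σ x ξ) (hS : S.PosDef)
    (hpos : ∀ i, 0 < residualVariance (e i) S θ σ) (i : Fin m) :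
    TendstoNormal P (fun n ω => √(n : ℝ) •
      (localOLS (e i) θ (x i) (ξ i) n ω - transfer (e i) S *ᵥ θ)) (gaussianWeight (e i) S θ σ)⁻¹ :=
  tendstoGaussian_block (posSemidef_stackedCov hS hpos) (h.tendstoGaussian_stackedError hS hpos) i

theorem tendstoNormal_aggregate (h : IsFederatedSample P S σ x ξ)
    (hcover : ∀ k, ∃ i a, e i (Sum.inl a) = k) (hS : S.PosDef)
    (hpos : ∀ i, 0 < residualVariance (e i) S θ σ)
    {What : ℕ → Ω → ∀ i, Matrix (Fin (p i)) (Fin (p i)) ℝ}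
    {W : ∀ i, Matrix (Fin (p i)) (Fin (p i)) ℝ}
    (hW : ∀ i, IsPosDefConsistent P (fun n ω => What n ω i) (W i)) {est : ℕ → Ω → Fin d → ℝ}
    (hest : IsAggregate P e S What (fun n ω i => localOLS (e i) θ (x i) (ξ i) n ω) est) :
    TendstoNormal P (fun n ω => √(n : ℝ) • (est n ω - θ)) (aggregateCov e S θ σ W) := by
  have hW_block := IsPosDefConsistent.blockDiagonal' hW
  have hW_posDef (i) := (hW i).posDef
  rw [aggregateCov_eq_wlsMatrix_mul fun i => (hW_posDef i).isHermitian]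
  refine TendstoGaussian.congr_ae_eventually
    ((h.tendstoGaussian_stackedError hS hpos).mulVec_of_tendsto (posSemidef_stackedCov hS hpos)
      (A := fun n ω => wlsMatrix (stackedTransfer e S) (blockDiagonal' (What n ω)))
      (fun n => (measurable_wlsMatrix _).comp_aemeasurable (hW_block.aemeasurable n)) ?_)
    (fun n => ((hest.aemeasurable n).sub_const θ).const_smul (√(n : ℝ))) ?_
  · filter_upwards [hW_block.tendsto_ae] with ω hω
    exact (continuousAt_wlsMatrix
      (isUnit_det_stackedTransfer hcover hS hW_posDef)).tendsto.comp hω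
  · filter_upwards [ae_all_iff.2 fun i => (hW i).eventually_posDef,
      ae_all_iff.2 hest.minimizes] with ω hω hmin
    filter_upwards [eventually_all.2 hω] with n hn
    rw [(isRiskMinimizer_iff_eq_wlsMatrix_mulVec hcover hS hn).1 (hmin n hn),
      wlsMatrix_mulVec_sub (isUnit_det_stackedTransfer hcover hS hn), ← mulVec_smul]
    rfl

end IsFederatedSample

end Federation

end Collab

end

theorem mainTheorem2_general {Ω : Type*} [MeasurableSpace Ω] {P : Measure Ω}
    [IsProbabilityMeasure P] {m d : ℕ} {p q : Fin m → ℕ}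
    {e : ∀ i, Fin (p i) ⊕ Fin (q i) ≃ Fin d} (hcover : ∀ k, ∃ i a, e i (Sum.inl a) = k)
    {S : Matrix (Fin d) (Fin d) ℝ} (hS : S.PosDef) {θ : Fin d → ℝ} {σ : ℝ≥0}
    (hpos : ∀ i, 0 < Collab.residualVariance (e i) S θ σ)
    {x : Fin m → ℕ → Ω → EuclideanSpace ℝ (Fin d)} {ξ : Fin m → ℕ → Ω → ℝ}
    (h : Collab.IsFederatedSample P S σ x ξ) :
    (∀ Shat : ℕ → Ω → ∀ i, Matrix (Fin (p i)) (Fin (p i)) ℝ,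
      (Shat = (fun n ω i =>
          Collab.sampleCov (Collab.obsData (e i) (Collab.dataMatrix (x i) n ω))) ∨
        Shat = fun _ _ i => Collab.blockPP (e i) S) →
      Tendsto (fun n => P {ω | ∀ i,
        ((Collab.localError (e i) θ (x i) (ξ i) n ω)⁻¹ • Shat n ω i).PosDef}) atTop (𝓝 1) ∧
      ∀ est : ℕ → Ω → Fin d → ℝ,
        Collab.IsAggregate P e S
          (fun n ω i => (Collab.localError (e i) θ (x i) (ξ i) n ω)⁻¹ • Shat n ω i)
          (fun n ω i => Collab.localOLS (e i) θ (x i) (ξ i) n ω) est →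
        Collab.TendstoNormal P (fun n ω => √(n : ℝ) • (est n ω - θ))
          (Collab.gaussianCov e S θ σ) ∧
        ∀ i, Collab.TendstoNormal P
          (fun n ω => √(n : ℝ) •
            (Collab.transfer (e i) S *ᵥ est n ω - Collab.transfer (e i) S *ᵥ θ))
          (Collab.transfer (e i) S * Collab.gaussianCov e S θ σ *
            (Collab.transfer (e i) S)ᵀ)) ∧
    (∀ W : ∀ i, Matrix (Fin (p i)) (Fin (p i)) ℝ, (∀ i, (W i).PosDef) →
      (Collab.information e S W).PosDef ∧
      (∀ b : ∀ i, Fin (p i) → ℝ, ∃! t, Collab.IsRiskMinimizer e S W b t) ∧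
      (∀ est : ℕ → Ω → Fin d → ℝ,
        Collab.IsAggregate P e S (fun _ _ => W)
          (fun n ω i => Collab.localOLS (e i) θ (x i) (ξ i) n ω) est →
        Collab.TendstoNormal P (fun n ω => √(n : ℝ) • (est n ω - θ))
          (Collab.aggregateCov e S θ σ W)) ∧
      (Collab.aggregateCov e S θ σ W -
        Collab.aggregateCov e S θ σ (fun i => Collab.gaussianWeight (e i) S θ σ)).PosSemidef) ∧
    (∀ i, (Collab.gaussianWeight (e i) S θ σ).PosDef) ∧
    Collab.aggregateCov e S θ σ (fun i => Collab.gaussianWeight (e i) S θ σ) =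
      Collab.gaussianCov e S θ σ ∧
    ∀ i,
      Collab.TendstoNormal P
        (fun n ω => √(n : ℝ) •
          (Collab.localOLS (e i) θ (x i) (ξ i) n ω - Collab.transfer (e i) S *ᵥ θ))
        (Collab.gaussianWeight (e i) S θ σ)⁻¹ ∧
      ((Collab.gaussianWeight (e i) S θ σ)⁻¹ -
        Collab.transfer (e i) S * Collab.gaussianCov e S θ σ *
          (Collab.transfer (e i) S)ᵀ).PosSemidef := by
  have hcov := Collab.aggregateCov_gaussianWeight hcover hS hpos
  refine ⟨fun Shat hShat => ?_, fun W hW => ⟨Collab.posDef_information hcover hS hW,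
    Collab.existsUnique_isRiskMinimizer hcover hS hW, fun est hest =>
      h.tendstoNormal_aggregate hcover hS hpos (fun i => .const (hW i)) hest, ?_⟩,
    fun i => Collab.posDef_gaussianWeight (e i) hS (hpos i), hcov, fun i =>
      ⟨h.tendstoNormal_localOLS hS hpos i,
        Collab.posSemidef_inv_gaussianWeight_sub hcover hS hpos i⟩⟩
  · have hShat_consistent (i) :
        Collab.IsPosDefConsistent P (fun n ω => Shat n ω i) (Collab.blockPP (e i) S) := by
      obtain rfl | rfl := hShat
      · exact (h.agent i).isPosDefConsistent_localCov hS (e i)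
      · exact .const (Collab.posDef_blockPP (e i) hS)
    have hWhat (i) := (h.agent i).isPosDefConsistent_inv_localError_smul hS (e i) (hpos i)
      (hShat_consistent i)
    refine ⟨Collab.tendsto_measure_forall_posDef hWhat, fun est hest => ?_⟩
    have hest_normal := h.tendstoNormal_aggregate hcover hS hpos hWhat hest
    rw [hcov] at hest_normal
    refine ⟨hest_normal, fun i => ?_⟩
    simp_rw [← mulVec_sub, ← mulVec_smul]
    exact Collab.TendstoGaussian.mulVec (Collab.posSemidef_gaussianCov hcover hS hpos)
      hest_normal (Collab.transfer (e i) S)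
  · rw [hcov]
    exact Collab.posSemidef_aggregateCov_sub_gaussianCov hcover hS hpos hW

theorem mainTheorem2 {Ω : Type*} [MeasurableSpace Ω] (P : Measure Ω) [IsProbabilityMeasure P]
    {m d : ℕ} {p q : Fin m → ℕ}
    -- the agents' views; every feature is observed by some agent
    (e : ∀ i, Fin (p i) ⊕ Fin (q i) ≃ Fin d)
    (hcover : ∀ k, ∃ i a, e i (Sum.inl a) = k)
    -- population covariance, ground truth, noise level
    (S : Matrix (Fin d) (Fin d) ℝ) (hS : S.PosDef)
    (θ : Fin d → ℝ) (σ : ℝ≥0)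
    (hpos : ∀ i, 0 < Collab.residualVariance (e i) S θ σ)
    -- agent `i` has features `x i j` and noise `ξ i j`, `j = 0, 1, 2, …`
    (x : Fin m → ℕ → Ω → EuclideanSpace ℝ (Fin d)) (ξ : Fin m → ℕ → Ω → ℝ)
    (hx : ∀ i j, HasLaw (x i j) (multivariateGaussian 0 S) P)
    (hξ : ∀ i j, HasLaw (ξ i j) (gaussianReal 0 (σ ^ 2)) P)
    (hxξ : ∀ i j, IndepFun (x i j) (ξ i j) P)
    (hindep : iIndepFun
      (fun (s : Fin m × ℕ) (ω : Ω) => (x s.1 s.2 ω, ξ s.1 s.2 ω)) P) :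
    -- asymptotic normality of the global and local Collab estimators, for plug-in weights built
    -- from the sample covariance or from the known covariance of the observed features
    (∀ Shat : ℕ → Ω → ∀ i, Matrix (Fin (p i)) (Fin (p i)) ℝ,
      (Shat = (fun n ω i =>
          Collab.sampleCov (Collab.obsData (e i) (Collab.dataMatrix (x i) n ω))) ∨
        Shat = fun _ _ i => Collab.blockPP (e i) S) →
      Tendsto (fun n => P {ω | ∀ i,
        ((Collab.localError (e i) θ (x i) (ξ i) n ω)⁻¹ • Shat n ω i).PosDef}) atTop (𝓝 1) ∧
      ∀ est : ℕ → Ω → Fin d → ℝ,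
        Collab.IsAggregate P e S
          (fun n ω i => (Collab.localError (e i) θ (x i) (ξ i) n ω)⁻¹ • Shat n ω i)
          (fun n ω i => Collab.localOLS (e i) θ (x i) (ξ i) n ω) est →
        Collab.TendstoNormal P (fun n ω => √(n : ℝ) • (est n ω - θ))
          (Collab.gaussianCov e S θ σ) ∧
        ∀ i, Collab.TendstoNormal P
          (fun n ω => √(n : ℝ) •
            (Collab.transfer (e i) S *ᵥ est n ω - Collab.transfer (e i) S *ᵥ θ))
          (Collab.transfer (e i) S * Collab.gaussianCov e S θ σ *
            (Collab.transfer (e i) S)ᵀ)) ∧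
    -- (i) for fixed weights the aggregated estimator is well defined and asymptotically normal
    -- with covariance `C(W)`, which is minimal at the weights `Wᵍ`
    (∀ W : ∀ i, Matrix (Fin (p i)) (Fin (p i)) ℝ, (∀ i, (W i).PosDef) →
      (Collab.information e S W).PosDef ∧
      (∀ b : ∀ i, Fin (p i) → ℝ, ∃! t, Collab.IsRiskMinimizer e S W b t) ∧
      (∀ est : ℕ → Ω → Fin d → ℝ,
        Collab.IsAggregate P e S (fun _ _ => W)
          (fun n ω i => Collab.localOLS (e i) θ (x i) (ξ i) n ω) est →
        Collab.TendstoNormal P (fun n ω => √(n : ℝ) • (est n ω - θ))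
          (Collab.aggregateCov e S θ σ W)) ∧
      (Collab.aggregateCov e S θ σ W -
        Collab.aggregateCov e S θ σ (fun i => Collab.gaussianWeight (e i) S θ σ)).PosSemidef) ∧
    (∀ i, (Collab.gaussianWeight (e i) S θ σ).PosDef) ∧
    Collab.aggregateCov e S θ σ (fun i => Collab.gaussianWeight (e i) S θ σ) =
      Collab.gaussianCov e S θ σ ∧
    -- (ii) the local least squares estimates are asymptotically normal, with a covariance that
    -- dominates that of the local Collab estimator
    ∀ i,
      Collab.TendstoNormal P
        (fun n ω => √(n : ℝ) •
          (Collab.localOLS (e i) θ (x i) (ξ i) n ω - Collab.transfer (e i) S *ᵥ θ))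
        (Collab.gaussianWeight (e i) S θ σ)⁻¹ ∧
      ((Collab.gaussianWeight (e i) S θ σ)⁻¹ -
        Collab.transfer (e i) S * Collab.gaussianCov e S θ σ *
          (Collab.transfer (e i) S)ᵀ).PosSemidef :=
  mainTheorem2_general hcover hS hpos (.of_hasLaw_gaussianReal hx hξ hxξ hindep)
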